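/- Let $m,n,\nu,K$ be integers, $A\in\mathbf{R}^{m\times n}$, $\sigma>0$, and let $B\in\mathbf{R}^{\nu\times n}$ be nonzero with trivial kernel. Let $S_1,\dots,S_K$ be positive semidefinite $n\times n$ matrices with $\sum_kS_k\succ0$, and let $\mathcal{T}\subset\mathbf{R}^K_+$ be a convex compact set which contains a vector with all entries positive and is monotone ($0\le\tau\le t$, $t\in\mathcal{T}$ imply $\tau\in\mathcal{T}$). Let $$\mathcal{X}=\{x\in\mathbf{R}^n:\ \exists t\in\mathcal{T}:\ x^TS_kx\le t_k,\ 1\le k\le K\}.$$ For a Borel function (estimate) $\widehat w:\mathbf{R}^m\to\mathbf{R}^\nu$ put $$\mathrm{Risk}[\widehat w|\mathcal{X}]=\sup_{x\in\mathcal{X}}\Big[\mathbf{E}_{\xi\sim\mathcal{N}(0,I_m)}\|\widehat w(Ax+\sigma\xi)-Bx\|_2^2\Big]^{1/2},\qquad \mathrm{Risk}_{\mathrm{opt}}[\mathcal{X}]=\inf_{\widehat w}\mathrm{Risk}[\widehat w|\mathcal{X}],$$ the infimum being over all Borel estimates. With $\phi_{\mathcal{T}}(\lambda)=\max_{t\in\mathcal{T}}\lambda^Tt$,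 consider the optimization problem $$\min_{H\in\mathbf{R}^{m\times\nu},\,\lambda\in\mathbf{R}^K}\Big\{\sigma^2\mathrm{Tr}(H^TH)+\phi_{\mathcal{T}}(\lambda):\ (B-H^TA)^T(B-H^TA)\preceq\sum_k\lambda_kS_k,\ \lambda\ge0\Big\}.\qquad(*)$$ Let $\|A\|$ be the spectral norm of $A$, $T=\max_{t\in\mathcal{T}}\sum_kt_k$, $\varkappa=\lambda_{\min}(\sum_kS_k)$, $\mathrm{Cond}(\mathcal{T})=\sqrt{T/\max_{t\in\mathcal{T}}\min_{k\le K}t_k}$, $\mathrm{Cond}(B)=\sigma_{\max}(B)/\sigma_{\min}(B)$ (the ratio of the largest and the smallest singular value), and $$\Theta=K\,\mathrm{Cond}^2(B)\Big[\mathrm{Cond}^2(\mathcal{T})+\frac{\|A\|^2T}{\sigma^2\varkappa}\Big].$$ There is an absolute constant $C>0$ such that for all such data problem $(*)$ has an optimal solution and, for every optimal solution $(H_*,\lambda_*)$ of $(*)$, the linear estimate $\widehat w_{H_*}(\omega)=H_*^T\omega$ satisfies $$\mathrm{Risk}[\widehat w_{H_*}|\mathcal{X}]\le C\sqrt{\ln(2\Theta)}\;\mathrm{Risk}_{\mathrm{opt}}[\mathcal{X}],$$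 and, if $K\ge2$, also $$\mathrm{Risk}[\widehat w_{H_*}|\mathcal{X}]\le C\sqrt{\ln\Theta}\;\mathrm{Risk}_{\mathrm{opt}}[\mathcal{X}].$$ -/

import Mathlib

open MeasureTheory ProbabilityTheory
open scoped ENNReal Matrix

noncomputable section

namespace Ellitope

/-- The standing assumptions on the data `S₁, …, S_K`, `𝒯` of an ellitope: the `S_k` are positive
semidefinite with positive definite sum, and `𝒯` is a convex compact monotone subset of the
nonnegative orthant that contains a strictly positive vector. -/
structure IsEllitopeData {n K : ℕ} (S : Fin K → Matrix (Fin n) (Fin n) ℝ)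
    (T : Set (Fin K → ℝ)) : Prop where
  posSemidef : ∀ k, (S k).PosSemidef
  sum_posDef : (∑ k, S k).PosDef
  convex : Convex ℝ T
  isCompact : IsCompact T
  nonneg : ∀ t ∈ T, 0 ≤ t
  exists_pos : ∃ t ∈ T, ∀ k, 0 < t k
  monotone : ∀ t ∈ T, ∀ τ, 0 ≤ τ → τ ≤ t → τ ∈ T

/-- The ellitope `{x : ∃ t ∈ 𝒯, xᵀ S_k x ≤ t_k for all k}`. -/
def ellitope {n K : ℕ} (S : Fin K → Matrix (Fin n) (Fin n) ℝ) (T : Set (Fin K → ℝ)) :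
    Set (EuclideanSpace ℝ (Fin n)) :=
  {x | ∃ t ∈ T, ∀ k, x.ofLp ⬝ᵥ (S k *ᵥ x.ofLp) ≤ t k}

/-- The worst-case risk `sup_{x ∈ X} (E ‖w (A x + σ ξ) - B x‖²)^{1/2}`, `ξ ∼ N(0, I_m)`, of an
estimate `w`, as an extended nonnegative real. -/
def risk {m n ν : ℕ} (A : Matrix (Fin m) (Fin n) ℝ) (B : Matrix (Fin ν) (Fin n) ℝ) (σ : ℝ)
    (X : Set (EuclideanSpace ℝ (Fin n)))
    (w : EuclideanSpace ℝ (Fin m) → EuclideanSpace ℝ (Fin ν)) : ℝ≥0∞ :=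
  ⨆ x ∈ X, (∫⁻ ξ, ‖w (Matrix.toEuclideanLin A x + σ • ξ) - Matrix.toEuclideanLin B x‖ₑ ^ 2
    ∂(stdGaussian (EuclideanSpace ℝ (Fin m)))) ^ (1 / 2 : ℝ)

/-- The minimax risk: the infimum of the risk over all Borel estimates. -/
def riskOpt {m n ν : ℕ} (A : Matrix (Fin m) (Fin n) ℝ) (B : Matrix (Fin ν) (Fin n) ℝ) (σ : ℝ)
    (X : Set (EuclideanSpace ℝ (Fin n))) : ℝ≥0∞ :=
  ⨅ (w : EuclideanSpace ℝ (Fin m) → EuclideanSpace ℝ (Fin ν)) (_ : Measurable w), risk A B σ X w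

/-- The linear estimate `ω ↦ Hᵀ ω`. -/
def linearEstimate {m ν : ℕ} (H : Matrix (Fin m) (Fin ν) ℝ) :
    EuclideanSpace ℝ (Fin m) → EuclideanSpace ℝ (Fin ν) :=
  fun ω => Matrix.toEuclideanLin Hᵀ ω

/-- The support function `λ ↦ max_{t ∈ 𝒯} λᵀ t` of `𝒯`. -/
def supportFn {K : ℕ} (T : Set (Fin K → ℝ)) (lam : Fin K → ℝ) : ℝ :=
  sSup ((fun t => lam ⬝ᵥ t) '' T)

/-- Feasibility of `(H, λ)`: `λ ≥ 0` and `(B - Hᵀ A)ᵀ (B - Hᵀ A) ⪯ ∑ λ_k S_k`. -/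
def IsFeasible {m n ν K : ℕ} (A : Matrix (Fin m) (Fin n) ℝ) (B : Matrix (Fin ν) (Fin n) ℝ)
    (S : Fin K → Matrix (Fin n) (Fin n) ℝ)
    (H : Matrix (Fin m) (Fin ν) ℝ) (lam : Fin K → ℝ) : Prop :=
  0 ≤ lam ∧ (∑ k, lam k • S k - (B - Hᵀ * A)ᵀ * (B - Hᵀ * A)).PosSemidef

/-- The objective `σ² Tr(Hᵀ H) + φ_𝒯(λ)`. -/
def objective {m ν K : ℕ} (σ : ℝ) (T : Set (Fin K → ℝ))
    (H : Matrix (Fin m) (Fin ν) ℝ) (lam : Fin K → ℝ) : ℝ :=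
  σ ^ 2 * (Hᵀ * H).trace + supportFn T lam

/-- `(H, λ)` is an optimal solution of the problem of minimizing the objective over all feasible
pairs. -/
def IsOptimalSolution {m n ν K : ℕ} (A : Matrix (Fin m) (Fin n) ℝ) (B : Matrix (Fin ν) (Fin n) ℝ)
    (σ : ℝ) (S : Fin K → Matrix (Fin n) (Fin n) ℝ) (T : Set (Fin K → ℝ))
    (H : Matrix (Fin m) (Fin ν) ℝ) (lam : Fin K → ℝ) : Prop :=
  IsFeasible A B S H lam ∧
    ∀ H' lam', IsFeasible A B S H' lam' → objective σ T H lam ≤ objective σ T H' lam'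

/-- The spectral norm of a matrix. -/
def specNorm {m n : ℕ} (A : Matrix (Fin m) (Fin n) ℝ) : ℝ :=
  ‖LinearMap.toContinuousLinearMap (Matrix.toEuclideanLin A)‖

/-- The smallest eigenvalue of a symmetric matrix (of positive size). -/
def minEigenvalue {n : ℕ} (M : Matrix (Fin n) (Fin n) ℝ) : ℝ :=
  sInf {μ : ℝ | Module.End.HasEigenvalue (Matrix.toLin' M) μ}

/-- The size `max_{t ∈ 𝒯} ∑ t_k` of `𝒯`. -/
def sizeT {K : ℕ} (T : Set (Fin K → ℝ)) : ℝ :=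
  sSup ((fun t => ∑ k, t k) '' T)

/-- The condition number `√(max_{t ∈ 𝒯} ∑ t_k / max_{t ∈ 𝒯} min_k t_k)` of `𝒯`. -/
def condT {K : ℕ} (T : Set (Fin K → ℝ)) : ℝ :=
  √(sizeT T / sSup ((fun t => ⨅ k, t k) '' T))

/-- The condition number `σ_max(B) / σ_min(B)` of a matrix with `n ≥ 1` columns and trivial kernel,
whose singular values are `σ₀ ≥ ⋯ ≥ σ_{n-1} > 0`. -/
def condB {n ν : ℕ} (B : Matrix (Fin ν) (Fin n) ℝ) : ℝ :=
  (Matrix.toEuclideanLin B).singularValues 0 / (Matrix.toEuclideanLin B).singularValues (n - 1)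

/-- The quantity `K Cond²(B) [Cond²(𝒯) + ‖A‖² T / (σ² ϰ)]` under the logarithm, with
`T = max_{t ∈ 𝒯} ∑ t_k` and `ϰ = λ_min(∑ S_k)`. -/
def logArg {m n ν K : ℕ} (A : Matrix (Fin m) (Fin n) ℝ) (B : Matrix (Fin ν) (Fin n) ℝ) (σ : ℝ)
    (S : Fin K → Matrix (Fin n) (Fin n) ℝ) (T : Set (Fin K → ℝ)) : ℝ :=
  K * condB B ^ 2 *
    (condT T ^ 2 + specNorm A ^ 2 * sizeT T / (σ ^ 2 * minEigenvalue (∑ k, S k)))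

end Ellitope

end

open MeasureTheory ProbabilityTheory
open scoped ENNReal Matrix

noncomputable section

namespace Ellitope

/-! ### Moments and exponential moments of Gaussian linear forms -/

section Gaussian

variable {E : Type*} [NormedAddCommGroup E] [InnerProductSpace ℝ E] [FiniteDimensional ℝ E]
  [MeasurableSpace E] [BorelSpace E]

/-! Write Opt for the optimal value of `(*)`. A feasible `(H, λ)` has squared risk at most its
objective (`IsFeasible.risk_le`), so the point is to prove Opt ≤ C ln(2Θ) Risk², up to an absolute
constant, for an arbitrary estimate.

By minimax duality (`IsOptimalSolution.exists_covariance`), Opt is, up to an arbitrarily small loss,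
the minimum over `H` of σ² Tr(HᵀH) + Tr((B - HᵀA) Q (B - HᵀA)ᵀ) for some Q ⪰ 0 and t ∈ 𝒯 with Tr(S_k
Q) ≤ t_k. For the prior x ∼ N(0, Q) this minimum is the Bayes risk among linear estimates. For a
Gaussian prior the residual of the best linear estimate is independent of the observation, so
nonlinear estimates do no better (`bayes_risk_lower_bound`).

This prior satisfies the constraints xᵀS_k x ≤ t_k only on average. Shrinking it to N(0, ρQ) costs
at most a factor ρ of the Bayes risk, and since E exp(xᵀS_k x / (4 t_k)) ≤ 2 under N(0, Q), leaving
the ellitope becomes exponentially unlikely in 1/ρ. With N a bound of ‖Bx‖² on the ellitope, the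
estimate may be truncated at 2√N, and the part of the Bayes risk from outside is then at most 160 K
N exp(-1/(8ρ)) (`ofReal_le_risk_sq_add`).

Finally K N ≤ 8 Θ Opt (`IsFeasible.card_mul_imageRadiusSq_le`), which is where Θ comes from. So ρ of
order 1/ln(2Θ) makes the correction at most half of the main term, whose order is Opt / ln(2Θ). -/

lemma map_inner_stdGaussian (g : E) :
    (stdGaussian E).map (fun ξ => inner ℝ g ξ) = gaussianReal 0 (‖g‖ ^ 2).toNNReal := by
  have h := IsGaussian.map_eq_gaussianReal (μ := stdGaussian E) (innerSL ℝ g)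
  rw [variance_dual_stdGaussian, integral_strongDual_stdGaussian, innerSL_apply_norm] at h
  exact h

lemma memLp_inner_stdGaussian (g : E) :
    MemLp (fun ξ => inner ℝ g ξ) 2 (stdGaussian E) :=
  ((IsGaussian.hasGaussianLaw_id (μ := stdGaussian E)).map (innerSL ℝ g)).memLp_two

lemma integral_inner_stdGaussian (g : E) : ∫ ξ, inner ℝ g ξ ∂(stdGaussian E) = 0 :=
  integral_strongDual_stdGaussian (innerSL ℝ g)

lemma integral_sq_inner_stdGaussian (g : E) :
    ∫ ξ, (inner ℝ g ξ) ^ 2 ∂(stdGaussian E) = ‖g‖ ^ 2 := by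
  have h := variance_dual_stdGaussian (innerSL ℝ g : StrongDual ℝ E)
  rw [variance_eq_integral (by fun_prop), innerSL_apply_norm,
    integral_strongDual_stdGaussian] at h
  simpa using h

lemma integrable_const_add_inner_sq (c : ℝ) (g : E) :
    Integrable (fun ξ => (c + inner ℝ g ξ) ^ 2) (stdGaussian E) :=
  ((memLp_const c).add (memLp_inner_stdGaussian g)).integrable_sq

lemma integral_const_add_inner_sq (c : ℝ) (g : E) :
    ∫ ξ, (c + inner ℝ g ξ) ^ 2 ∂(stdGaussian E) = c ^ 2 + ‖g‖ ^ 2 := by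
  have h1 : Integrable (fun ξ => inner ℝ g ξ) (stdGaussian E) :=
    (memLp_inner_stdGaussian g).integrable (by norm_num)
  have h2 : Integrable (fun ξ => (inner ℝ g ξ) ^ 2) (stdGaussian E) :=
    (memLp_inner_stdGaussian g).integrable_sq
  have : (fun ξ => (c + inner ℝ g ξ) ^ 2) =
      fun ξ => (c ^ 2 + (2 * c) * inner ℝ g ξ) + (inner ℝ g ξ) ^ 2 := by
    ext; ring
  have h3 : Integrable (fun ξ => c ^ 2 + (2 * c) * inner ℝ g ξ) (stdGaussian E) :=
    (integrable_const _).add (h1.const_mul _)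
  rw [this, integral_add h3 h2,
    integral_add (integrable_const _) (h1.const_mul _), integral_const_mul,
    integral_inner_stdGaussian, integral_sq_inner_stdGaussian]
  simp

lemma lintegral_exp_sq_gaussianReal :
    ∫⁻ z, ENNReal.ofReal (Real.exp (z ^ 2 / 4)) ∂(gaussianReal 0 1) ≤ 2 := by
  rw [gaussianReal_of_var_ne_zero _ one_ne_zero,
    lintegral_withDensity_eq_lintegral_mul _ (measurable_gaussianPDF 0 1) (by fun_prop)]
  have h : ∀ z : ℝ, (gaussianPDF 0 1 * fun z => ENNReal.ofReal (Real.exp (z ^ 2 / 4))) z =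
      ENNReal.ofReal ((√(2 * Real.pi))⁻¹ * Real.exp (-(1 / 4) * z ^ 2)) := by
    intro z
    simp only [Pi.mul_apply, gaussianPDF, gaussianPDFReal]
    rw [← ENNReal.ofReal_mul (by positivity), mul_assoc, ← Real.exp_add]
    congr 2
    · simp
    · congr 1; simp; ring
  simp_rw [h]
  rw [← ofReal_integral_eq_lintegral_ofReal
    ((integrable_exp_neg_mul_sq (by norm_num)).const_mul _) (ae_of_all _ fun _ => by positivity),
    integral_const_mul, integral_gaussian]
  have : (√(2 * Real.pi))⁻¹ * √(Real.pi / (1 / 4)) ≤ 2 := by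
    rw [inv_mul_le_iff₀ (by positivity)]
    apply Real.sqrt_le_iff.2 ⟨by positivity, ?_⟩
    rw [mul_pow, Real.sq_sqrt (by positivity)]
    nlinarith [Real.pi_pos]
  calc _ ≤ ENNReal.ofReal 2 := ENNReal.ofReal_le_ofReal this
    _ = 2 := by simp

lemma lintegral_exp_inner_sq {g : E} (hg : ‖g‖ = 1) :
    ∫⁻ ξ, ENNReal.ofReal (Real.exp ((inner ℝ g ξ) ^ 2 / 4)) ∂(stdGaussian E) ≤ 2 := by
  have h := map_inner_stdGaussian g
  rw [hg] at h
  simp only [one_pow, Real.toNNReal_one] at h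
  refine le_trans (le_of_eq ?_) lintegral_exp_sq_gaussianReal
  rw [← h, lintegral_map (by fun_prop) (by fun_prop)]

/-- A sum of squares of Gaussian linear forms of total variance at most `t` has a bounded
exponential moment. -/
lemma lintegral_exp_sum_inner_sq {ι : Type*} [Fintype ι] (r : ι → E) {t : ℝ} (ht : 0 < t)
    (hr : ∑ i, ‖r i‖ ^ 2 ≤ t) :
    ∫⁻ ξ, ENNReal.ofReal (Real.exp ((∑ i, (inner ℝ (r i) ξ) ^ 2) / t / 4)) ∂(stdGaussian E)
      ≤ 2 := by
  have key : ∀ ξ : E, Real.exp ((∑ i, (inner ℝ (r i) ξ) ^ 2) / t / 4) ≤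
      (1 - (∑ i, ‖r i‖ ^ 2) / t) + ∑ i, ‖r i‖ ^ 2 / t *
        Real.exp ((inner ℝ (‖r i‖⁻¹ • r i) ξ) ^ 2 / 4) := by
    intro ξ
    -- Jensen with weights ‖r_i‖²/t at the squares of normalized forms; the missing weight sits at
    -- the point 0, indexed by `none`.
    have hJ := convexOn_exp.map_sum_le (t := (Finset.univ : Finset (Option ι)))
      (w := fun o => o.elim (1 - (∑ i, ‖r i‖ ^ 2) / t) fun i => ‖r i‖ ^ 2 / t)
      (p := fun o => o.elim 0 fun i => (inner ℝ (‖r i‖⁻¹ • r i) ξ) ^ 2 / 4)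
      (by
        rintro (_ | i) _
        · simpa using (div_le_one ht).2 hr
        · simp only [Option.elim_some]; positivity)
      (by simp [Fintype.sum_option, Finset.sum_div]) (by simp)
    simp only [Fintype.sum_option, Option.elim_none, Option.elim_some, smul_eq_mul, mul_zero,
      zero_add, Real.exp_zero, mul_one] at hJ
    refine le_trans (le_of_eq ?_) hJ
    congr 1
    rw [Finset.sum_div, Finset.sum_div]
    refine Finset.sum_congr rfl fun i _ => ?_
    rcases eq_or_ne (r i) 0 with h0 | h0
    · simp [h0]
    · have : ‖r i‖ ≠ 0 := norm_ne_zero_iff.2 h0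
      rw [real_inner_smul_left]
      field_simp
  have hw : ∀ i, 0 ≤ ‖r i‖ ^ 2 / t := fun i => by positivity
  have h1 : 0 ≤ 1 - (∑ i, ‖r i‖ ^ 2) / t := sub_nonneg.2 ((div_le_one ht).2 hr)
  calc _ ≤ ∫⁻ ξ, (ENNReal.ofReal (1 - (∑ i, ‖r i‖ ^ 2) / t) + ∑ i, ENNReal.ofReal (‖r i‖ ^ 2 / t) *
        ENNReal.ofReal (Real.exp ((inner ℝ (‖r i‖⁻¹ • r i) ξ) ^ 2 / 4))) ∂(stdGaussian E) := by
        refine lintegral_mono fun ξ => ?_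
        refine (ENNReal.ofReal_le_ofReal (key ξ)).trans ?_
        rw [ENNReal.ofReal_add h1 (Finset.sum_nonneg fun i _ => mul_nonneg (hw i) (Real.exp_nonneg _)),
          ENNReal.ofReal_sum_of_nonneg fun i _ => mul_nonneg (hw i) (Real.exp_nonneg _)]
        simp_rw [ENNReal.ofReal_mul (hw _)]
        exact le_rfl
    _ = ENNReal.ofReal (1 - (∑ i, ‖r i‖ ^ 2) / t) + ∑ i, ENNReal.ofReal (‖r i‖ ^ 2 / t) *
        ∫⁻ ξ, ENNReal.ofReal (Real.exp ((inner ℝ (‖r i‖⁻¹ • r i) ξ) ^ 2 / 4))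
          ∂(stdGaussian E) := by
        rw [lintegral_add_left measurable_const, lintegral_finsetSum _ (by fun_prop)]
        simp only [lintegral_const, measure_univ, mul_one]
        congr 1
        refine Finset.sum_congr rfl fun i _ => ?_
        rw [lintegral_const_mul _ (by fun_prop)]
    _ ≤ ENNReal.ofReal (1 - (∑ i, ‖r i‖ ^ 2) / t) * 2 +
        ∑ i, ENNReal.ofReal (‖r i‖ ^ 2 / t) * 2 := by
        gcongr with i
        · exact le_mul_of_one_le_right' (by norm_num)
        · rcases eq_or_ne (r i) 0 with h0 | h0
          · simp [h0]
          · apply lintegral_exp_inner_sq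
            rw [norm_smul, norm_inv, norm_norm, inv_mul_cancel₀ (norm_ne_zero_iff.2 h0)]
    _ = 2 := by
        rw [← Finset.sum_mul, ← add_mul, ← ENNReal.ofReal_sum_of_nonneg fun i _ => hw i,
          ← ENNReal.ofReal_add h1 (Finset.sum_nonneg fun i _ => hw i), ← Finset.sum_div]
        simp

end Gaussian

/-! ### Gaussian vectors transformed by matrices -/

section MatrixGaussian

variable {p q r : ℕ}

lemma toEuclideanLin_apply_eq_inner (G : Matrix (Fin p) (Fin q) ℝ) (ξ : EuclideanSpace ℝ (Fin q))
    (i : Fin p) : Matrix.toEuclideanLin G ξ i = inner ℝ (WithLp.toLp 2 (G i)) ξ := by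
  simp [Matrix.toLpLin_apply, Matrix.mulVec, dotProduct, PiLp.inner_apply, mul_comm]

lemma sum_norm_row_sq (G : Matrix (Fin p) (Fin q) ℝ) :
    ∑ i, ‖(WithLp.toLp 2 (G i) : EuclideanSpace ℝ (Fin q))‖ ^ 2 = (G * Gᵀ).trace := by
  simp_rw [EuclideanSpace.real_norm_sq_eq]
  simp [Matrix.trace, Matrix.mul_apply, sq]

lemma trace_mul_transpose_nonneg (G : Matrix (Fin p) (Fin q) ℝ) : 0 ≤ (G * Gᵀ).trace := by
  rw [← sum_norm_row_sq]; positivity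

lemma norm_toEuclideanLin_sq_eq_sum (G : Matrix (Fin p) (Fin q) ℝ)
    (ξ : EuclideanSpace ℝ (Fin q)) : ‖Matrix.toEuclideanLin G ξ‖ ^ 2 =
      ∑ i, (inner ℝ (WithLp.toLp 2 (G i) : EuclideanSpace ℝ (Fin q)) ξ) ^ 2 := by
  simp_rw [EuclideanSpace.real_norm_sq_eq, toEuclideanLin_apply_eq_inner]

lemma norm_toEuclideanLin_sq_le (G : Matrix (Fin p) (Fin q) ℝ) (ξ : EuclideanSpace ℝ (Fin q)) :
    ‖Matrix.toEuclideanLin G ξ‖ ^ 2 ≤ (G * Gᵀ).trace * ‖ξ‖ ^ 2 := by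
  rw [norm_toEuclideanLin_sq_eq_sum, ← sum_norm_row_sq, Finset.sum_mul]
  gcongr with i
  rw [← mul_pow, ← sq_abs]
  gcongr
  exact abs_real_inner_le_norm _ _

lemma continuous_toEuclideanLin (G : Matrix (Fin p) (Fin q) ℝ) :
    Continuous (Matrix.toEuclideanLin G) :=
  LinearMap.continuous_of_finiteDimensional _

lemma measurable_toEuclideanLin (G : Matrix (Fin p) (Fin q) ℝ) :
    Measurable (Matrix.toEuclideanLin G) :=
  (continuous_toEuclideanLin G).measurable

lemma inner_toEuclideanLin (G : Matrix (Fin p) (Fin q) ℝ) (a : EuclideanSpace ℝ (Fin p))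
    (ξ : EuclideanSpace ℝ (Fin q)) :
    inner ℝ a (Matrix.toEuclideanLin G ξ) = inner ℝ (Matrix.toEuclideanLin Gᵀ a) ξ := by
  simp only [EuclideanSpace.inner_eq_star_dotProduct, Matrix.toLpLin_apply, star_trivial]
  rw [Matrix.mulVec_transpose, dotProduct_comm, Matrix.dotProduct_mulVec, dotProduct_comm]

lemma toEuclideanLin_mul (G : Matrix (Fin p) (Fin q) ℝ) (G' : Matrix (Fin q) (Fin r) ℝ)
    (x : EuclideanSpace ℝ (Fin r)) :
    Matrix.toEuclideanLin (G * G') x = Matrix.toEuclideanLin G (Matrix.toEuclideanLin G' x) := by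
  simp [Matrix.toLpLin_apply]

lemma integrable_norm_add_toEuclideanLin_sq (c : EuclideanSpace ℝ (Fin p))
    (G : Matrix (Fin p) (Fin q) ℝ) :
    Integrable (fun ξ => ‖c + Matrix.toEuclideanLin G ξ‖ ^ 2)
      (stdGaussian (EuclideanSpace ℝ (Fin q))) := by
  simp_rw [EuclideanSpace.real_norm_sq_eq, PiLp.add_apply, toEuclideanLin_apply_eq_inner]
  exact integrable_finsetSum _ fun i _ => integrable_const_add_inner_sq _ _

lemma integral_norm_add_toEuclideanLin_sq (c : EuclideanSpace ℝ (Fin p))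
    (G : Matrix (Fin p) (Fin q) ℝ) :
    ∫ ξ, ‖c + Matrix.toEuclideanLin G ξ‖ ^ 2 ∂(stdGaussian (EuclideanSpace ℝ (Fin q))) =
      ‖c‖ ^ 2 + (G * Gᵀ).trace := by
  simp_rw [EuclideanSpace.real_norm_sq_eq, PiLp.add_apply, toEuclideanLin_apply_eq_inner]
  rw [integral_finsetSum _ fun i _ => integrable_const_add_inner_sq _ _]
  simp_rw [integral_const_add_inner_sq, Finset.sum_add_distrib, sum_norm_row_sq]

lemma lintegral_exp_norm_toEuclideanLin_sq (G : Matrix (Fin p) (Fin q) ℝ) {t : ℝ} (ht : 0 < t)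
    (hG : (G * Gᵀ).trace ≤ t) :
    ∫⁻ ξ, ENNReal.ofReal (Real.exp (‖Matrix.toEuclideanLin G ξ‖ ^ 2 / t / 4))
      ∂(stdGaussian (EuclideanSpace ℝ (Fin q))) ≤ 2 := by
  simp_rw [norm_toEuclideanLin_sq_eq_sum]
  exact lintegral_exp_sum_inner_sq _ ht (by rwa [sum_norm_row_sq])

end MatrixGaussian

/-! ### Bayes risk under a Gaussian prior -/

section Bayes

variable {E F : Type*} [NormedAddCommGroup E] [InnerProductSpace ℝ E] [FiniteDimensional ℝ E]
  [MeasurableSpace E] [BorelSpace E] [NormedAddCommGroup F] [InnerProductSpace ℝ F]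
  [FiniteDimensional ℝ F] [MeasurableSpace F] [BorelSpace F]

lemma covariance_inner_stdGaussian (a b : E) :
    cov[fun ξ => inner ℝ a ξ, fun ξ => inner ℝ b ξ; stdGaussian E] = inner ℝ a b := by
  rw [← covarianceBilin_apply_eq_cov IsGaussian.memLp_two_id, covarianceBilin_stdGaussian,
    innerSL_apply_apply]

lemma covariance_inner_add_inner_prod (a a' : E) (b b' : F) :
    cov[fun z => inner ℝ a z.1 + inner ℝ b z.2, fun z => inner ℝ a' z.1 + inner ℝ b' z.2;
      (stdGaussian E).prod (stdGaussian F)] = inner ℝ a a' + inner ℝ b b' := by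
  set P := (stdGaussian E).prod (stdGaussian F)
  have m1 : ∀ a : E, MemLp (fun z : E × F => inner ℝ a z.1) 2 P :=
    fun a => (memLp_inner_stdGaussian a).comp_fst _
  have m2 : ∀ b : F, MemLp (fun z : E × F => inner ℝ b z.2) 2 P :=
    fun b => (memLp_inner_stdGaussian b).comp_snd _
  have c1 : cov[fun z => inner ℝ a z.1, fun z => inner ℝ a' z.1; P] = inner ℝ a a' := by
    rw [← covariance_inner_stdGaussian a a', ← (measurePreserving_fst (μ := stdGaussian E)
      (ν := stdGaussian F)).map_eq, covariance_map_fun (by fun_prop) (by fun_prop) (by fun_prop)]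
  have c2 : cov[fun z => inner ℝ b z.2, fun z => inner ℝ b' z.2; P] = inner ℝ b b' := by
    rw [← covariance_inner_stdGaussian b b', ← (measurePreserving_snd (μ := stdGaussian E)
      (ν := stdGaussian F)).map_eq, covariance_map_fun (by fun_prop) (by fun_prop) (by fun_prop)]
  have c3 : cov[fun z => inner ℝ a z.1, fun z => inner ℝ b' z.2; P] = 0 :=
    covariance_fst_snd_prod (memLp_inner_stdGaussian a) (memLp_inner_stdGaussian b')
  have c4 : cov[fun z => inner ℝ b z.2, fun z => inner ℝ a' z.1; P] = 0 := by
    rw [covariance_comm]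
    exact covariance_fst_snd_prod (memLp_inner_stdGaussian a') (memLp_inner_stdGaussian b)
  have e1 := covariance_add_left (m1 a) (m2 b) ((m1 a').add (m2 b'))
  rw [covariance_add_right (m1 a) (m1 a') (m2 b'), covariance_add_right (m2 b) (m1 a') (m2 b'),
    c1, c2, c3, c4] at e1
  simpa using! e1

/-- The matrix in `h` is the cross-covariance of the two vectors, and jointly Gaussian uncorrelated
vectors are independent. -/
lemma indepFun_of_mul_transpose_eq_zero {p q k l : ℕ} (U₁ : Matrix (Fin p) (Fin k) ℝ)
    (U₂ : Matrix (Fin p) (Fin l) ℝ) (V₁ : Matrix (Fin q) (Fin k) ℝ)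
    (V₂ : Matrix (Fin q) (Fin l) ℝ) (h : U₁ * V₁ᵀ + U₂ * V₂ᵀ = 0) :
    IndepFun (fun z : EuclideanSpace ℝ (Fin k) × EuclideanSpace ℝ (Fin l) =>
        Matrix.toEuclideanLin U₁ z.1 + Matrix.toEuclideanLin U₂ z.2)
      (fun z => Matrix.toEuclideanLin V₁ z.1 + Matrix.toEuclideanLin V₂ z.2)
      ((stdGaussian (EuclideanSpace ℝ (Fin k))).prod
        (stdGaussian (EuclideanSpace ℝ (Fin l)))) := by
  set P := (stdGaussian (EuclideanSpace ℝ (Fin k))).prod (stdGaussian (EuclideanSpace ℝ (Fin l)))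
  refine HasGaussianLaw.indepFun_of_covariance_inner ?_ fun x y => ?_
  · have h0 : HasGaussianLaw id P := IsGaussian.hasGaussianLaw_id
    exact h0.map (LinearMap.toContinuousLinearMap
      ((((Matrix.toEuclideanLin U₁).comp (LinearMap.fst ℝ _ _) +
        (Matrix.toEuclideanLin U₂).comp (LinearMap.snd ℝ _ _))).prod
      ((Matrix.toEuclideanLin V₁).comp (LinearMap.fst ℝ _ _) +
        (Matrix.toEuclideanLin V₂).comp (LinearMap.snd ℝ _ _))))
  · simp_rw [inner_add_right, inner_toEuclideanLin]
    rw [covariance_inner_add_inner_prod, ← inner_toEuclideanLin, ← inner_toEuclideanLin,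
      ← toEuclideanLin_mul, ← toEuclideanLin_mul, ← inner_add_right, ← LinearMap.add_apply,
      ← map_add, h]
    simp

/-- An estimate of the form `v(V)` of a centered Gaussian `U` independent of `V` is no better
than zero. -/
lemma integral_norm_sq_le_of_indepFun {Ω : Type*} [MeasurableSpace Ω] {P : Measure Ω} {p q : ℕ}
    {U : Ω → EuclideanSpace ℝ (Fin p)} {V : Ω → EuclideanSpace ℝ (Fin q)}
    (hU : MemLp U 2 P) (hU0 : ∀ i, ∫ z, U z i ∂P = 0) (hV : Measurable V) (hUV : IndepFun U V P)
    {v : EuclideanSpace ℝ (Fin q) → EuclideanSpace ℝ (Fin p)} (hv : Measurable v)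
    (hv2 : MemLp (fun z => v (V z)) 2 P) :
    ∫ z, ‖U z‖ ^ 2 ∂P ≤ ∫ z, ‖v (V z) - U z‖ ^ 2 ∂P := by
  have hUi : ∀ i, MemLp (fun z => U z i) 2 P := fun i => by
    simpa [EuclideanSpace.inner_single_left] using hU.const_inner (𝕜 := ℝ) (EuclideanSpace.basisFun (Fin p) ℝ i)
  have hvi : ∀ i, MemLp (fun z => v (V z) i) 2 P := fun i => by
    simpa [EuclideanSpace.inner_single_left] using hv2.const_inner (𝕜 := ℝ) (EuclideanSpace.basisFun (Fin p) ℝ i)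
  have hmul : ∀ i, Integrable (fun z => U z i * v (V z) i) P := fun i =>
    (hUi i).integrable_mul (hvi i)
  have hint : ∀ i, ∫ z, U z i * v (V z) i ∂P = 0 := by
    intro i
    have := hUV.integral_fun_comp_mul_comp (f := fun x => x i) (g := fun y => v y i)
      hU.aestronglyMeasurable.aemeasurable hV.aemeasurable
      (Measurable.aestronglyMeasurable (by fun_prop))
      (Measurable.aestronglyMeasurable (by fun_prop))
    rw [this, hU0, zero_mul]
  -- Expanding ‖v - U‖², the cross term has mean zero by independence and ‖v‖² is dropped.
  have hsum : ∫ z, (‖U z‖ ^ 2 - 2 * ∑ i, U z i * v (V z) i) ∂P = ∫ z, ‖U z‖ ^ 2 ∂P := by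
    rw [integral_sub hU.norm.integrable_sq
      ((integrable_finsetSum _ fun i _ => hmul i).const_mul 2), integral_const_mul,
      integral_finsetSum _ fun i _ => hmul i]
    simp [hint]
  rw [← hsum]
  refine integral_mono (hU.norm.integrable_sq.sub
    ((integrable_finsetSum _ fun i _ => hmul i).const_mul 2)) (hv2.sub hU).norm.integrable_sq ?_
  intro z
  simp only [EuclideanSpace.real_norm_sq_eq, PiLp.sub_apply, Finset.mul_sum,
    ← Finset.sum_sub_distrib]
  gcongr with i
  nlinarith [sq_nonneg (v (V z) i)]

/-- The normal equation of the regression of Bx on Ax + σξ for x of covariance Q = LLᵀ. It is solved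
by Hᵀ = BQAᵀ(AQAᵀ + σ²I)⁻¹, the inverse existing because σ > 0. -/
lemma exists_regression_matrix {m n ν : ℕ} (A : Matrix (Fin m) (Fin n) ℝ)
    (B : Matrix (Fin ν) (Fin n) ℝ) {σ : ℝ} (hσ : 0 < σ) (L : Matrix (Fin n) (Fin n) ℝ) :
    ∃ H : Matrix (Fin m) (Fin ν) ℝ, (B - Hᵀ * A) * (L * Lᵀ) * Aᵀ = σ ^ 2 • Hᵀ := by
  set V : Matrix (Fin m) (Fin m) ℝ := A * L * (A * L)ᵀ + σ ^ 2 • 1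
  have hV : V.PosDef := by
    have h1 : (A * L * (A * L)ᵀ).PosSemidef := by
      simpa using Matrix.posSemidef_self_mul_conjTranspose (A * L)
    exact Matrix.PosDef.posSemidef_add h1 (Matrix.PosDef.one.smul (by positivity))
  have hu : IsUnit V.det := (Matrix.isUnit_iff_isUnit_det _).1 hV.isUnit
  refine ⟨(B * (L * Lᵀ) * Aᵀ * V⁻¹)ᵀ, ?_⟩
  have h2 : B * (L * Lᵀ) * Aᵀ * V⁻¹ * V = B * (L * Lᵀ) * Aᵀ := by
    rw [Matrix.mul_assoc, Matrix.nonsing_inv_mul _ hu, Matrix.mul_one]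
  rw [Matrix.transpose_transpose, Matrix.sub_mul, Matrix.sub_mul, sub_eq_iff_eq_add]
  conv_lhs => rw [← h2]
  simp only [V, Matrix.mul_add, Matrix.transpose_mul, Matrix.mul_smul, Matrix.mul_one,
    Matrix.mul_assoc]
  rw [add_comm]

/-- For a Gaussian prior `L η` on the signal, no bounded estimate beats the best linear one. -/
lemma bayes_risk_lower_bound {m n ν : ℕ} (A : Matrix (Fin m) (Fin n) ℝ)
    (B : Matrix (Fin ν) (Fin n) ℝ) {σ : ℝ} (hσ : 0 < σ) (L : Matrix (Fin n) (Fin n) ℝ)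
    {w : EuclideanSpace ℝ (Fin m) → EuclideanSpace ℝ (Fin ν)} (hw : Measurable w) {D : ℝ}
    (hD : ∀ y, ‖w y‖ ≤ D) :
    ∃ H : Matrix (Fin m) (Fin ν) ℝ,
      ENNReal.ofReal (σ ^ 2 * (Hᵀ * H).trace +
        ((B - Hᵀ * A) * (L * Lᵀ) * (B - Hᵀ * A)ᵀ).trace) ≤
      ∫⁻ η, ∫⁻ ξ, ‖w (Matrix.toEuclideanLin A (Matrix.toEuclideanLin L η) + σ • ξ) -
        Matrix.toEuclideanLin B (Matrix.toEuclideanLin L η)‖ₑ ^ 2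
        ∂(stdGaussian (EuclideanSpace ℝ (Fin m))) ∂(stdGaussian (EuclideanSpace ℝ (Fin n))) := by
  obtain ⟨H, hH⟩ := exists_regression_matrix A B hσ L
  refine ⟨H, ?_⟩
  set P := (stdGaussian (EuclideanSpace ℝ (Fin n))).prod (stdGaussian (EuclideanSpace ℝ (Fin m)))
  -- With x = Lη and ω = Ax + σξ, the pair `U₁, U₂` gives the residual Bx - Hᵀω and `V₁, V₂` gives
  -- ω. The normal equation makes them uncorrelated.
  set U₁ : Matrix (Fin ν) (Fin n) ℝ := (B - Hᵀ * A) * L with hU₁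
  set U₂ : Matrix (Fin ν) (Fin m) ℝ := -(σ • Hᵀ) with hU₂
  set V₁ : Matrix (Fin m) (Fin n) ℝ := A * L with hV₁
  set V₂ : Matrix (Fin m) (Fin m) ℝ := σ • 1 with hV₂
  have hzero : U₁ * V₁ᵀ + U₂ * V₂ᵀ = 0 := by
    have : U₂ * V₂ᵀ = - (σ ^ 2 • Hᵀ) := by
      simp [hU₂, hV₂, smul_smul, sq]
    rw [this, ← hH, hU₁, hV₁, Matrix.transpose_mul]
    simp [Matrix.mul_assoc]
  have hind := indepFun_of_mul_transpose_eq_zero U₁ U₂ V₁ V₂ hzero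
  have hlin : ∀ {s : ℕ} (G₁ : Matrix (Fin s) (Fin n) ℝ) (G₂ : Matrix (Fin s) (Fin m) ℝ),
      HasGaussianLaw (fun z : EuclideanSpace ℝ (Fin n) × EuclideanSpace ℝ (Fin m) =>
        Matrix.toEuclideanLin G₁ z.1 + Matrix.toEuclideanLin G₂ z.2) P := by
    intro s G₁ G₂
    have h0 : HasGaussianLaw id P := IsGaussian.hasGaussianLaw_id
    exact h0.map (LinearMap.toContinuousLinearMap ((Matrix.toEuclideanLin G₁).comp
      (LinearMap.fst ℝ _ _) + (Matrix.toEuclideanLin G₂).comp (LinearMap.snd ℝ _ _)))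
  have hUmem := (hlin U₁ U₂).memLp_two
  have hVmeas : Measurable (fun z : EuclideanSpace ℝ (Fin n) × EuclideanSpace ℝ (Fin m) =>
        Matrix.toEuclideanLin V₁ z.1 + Matrix.toEuclideanLin V₂ z.2) :=
    ((measurable_toEuclideanLin _).comp measurable_fst).add
      ((measurable_toEuclideanLin _).comp measurable_snd)
  have hU0 : ∀ i, ∫ z : EuclideanSpace ℝ (Fin n) × EuclideanSpace ℝ (Fin m),
      (Matrix.toEuclideanLin U₁ z.1 + Matrix.toEuclideanLin U₂ z.2) i ∂P = 0 := by
    intro i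
    simp_rw [PiLp.add_apply, toEuclideanLin_apply_eq_inner]
    rw [integral_add
      (((memLp_inner_stdGaussian _).comp_fst _).integrable (by norm_num))
      (((memLp_inner_stdGaussian _).comp_snd _).integrable (by norm_num))]
    rw [integral_fun_fst (μ := stdGaussian (EuclideanSpace ℝ (Fin n)))
      (ν := stdGaussian (EuclideanSpace ℝ (Fin m))) (f := fun ξ => inner ℝ _ ξ),
      integral_fun_snd (μ := stdGaussian (EuclideanSpace ℝ (Fin n)))
      (ν := stdGaussian (EuclideanSpace ℝ (Fin m))) (f := fun ξ => inner ℝ _ ξ)]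
    simp [integral_inner_stdGaussian]
  -- The loss is w(ω) - Bx = (w - Hᵀ)(ω) - residual. Boundedness of `w` serves to make (w - Hᵀ)(ω)
  -- square integrable.
  have hvmeas : Measurable (fun y => w y - Matrix.toEuclideanLin Hᵀ y) :=
    hw.sub (measurable_toEuclideanLin _)
  have hv2 : MemLp (fun z : EuclideanSpace ℝ (Fin n) × EuclideanSpace ℝ (Fin m) =>
      w (Matrix.toEuclideanLin V₁ z.1 + Matrix.toEuclideanLin V₂ z.2) -
        Matrix.toEuclideanLin Hᵀ (Matrix.toEuclideanLin V₁ z.1 + Matrix.toEuclideanLin V₂ z.2))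
      2 P := by
    refine MemLp.sub (MemLp.of_bound (hw.comp hVmeas).aestronglyMeasurable D
      (ae_of_all _ fun z => hD _)) ?_
    exact ((hlin V₁ V₂).map (LinearMap.toContinuousLinearMap (Matrix.toEuclideanLin Hᵀ))).memLp_two
  have key := integral_norm_sq_le_of_indepFun hUmem hU0 hVmeas hind hvmeas hv2
  have hval : ∫ z : EuclideanSpace ℝ (Fin n) × EuclideanSpace ℝ (Fin m),
      ‖Matrix.toEuclideanLin U₁ z.1 + Matrix.toEuclideanLin U₂ z.2‖ ^ 2 ∂P =
      σ ^ 2 * (Hᵀ * H).trace + ((B - Hᵀ * A) * (L * Lᵀ) * (B - Hᵀ * A)ᵀ).trace := by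
    rw [integral_prod _ hUmem.norm.integrable_sq]
    simp_rw [integral_norm_add_toEuclideanLin_sq]
    have h1 := integrable_norm_add_toEuclideanLin_sq 0 U₁
    have h2 := integral_norm_add_toEuclideanLin_sq 0 U₁
    simp only [zero_add, norm_zero, ne_eq, OfNat.ofNat_ne_zero, not_false_eq_true, zero_pow]
      at h1 h2
    rw [integral_add h1 (integrable_const _), h2]
    simp only [integral_const, probReal_univ, one_smul]
    rw [add_comm, hU₁, hU₂]
    congr 1
    · simp [smul_smul, sq]
    · simp [Matrix.mul_assoc]
  have heq : ∀ z : EuclideanSpace ℝ (Fin n) × EuclideanSpace ℝ (Fin m),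
      w (Matrix.toEuclideanLin V₁ z.1 + Matrix.toEuclideanLin V₂ z.2) -
        Matrix.toEuclideanLin Hᵀ (Matrix.toEuclideanLin V₁ z.1 + Matrix.toEuclideanLin V₂ z.2) -
        (Matrix.toEuclideanLin U₁ z.1 + Matrix.toEuclideanLin U₂ z.2) =
      w (Matrix.toEuclideanLin A (Matrix.toEuclideanLin L z.1) + σ • z.2) -
        Matrix.toEuclideanLin B (Matrix.toEuclideanLin L z.1) := by
    intro z
    have e2 : Matrix.toEuclideanLin V₂ z.2 = σ • z.2 := by
      ext i
      simp [hV₂]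
    have e3 : Matrix.toEuclideanLin U₂ z.2 = -(σ • Matrix.toEuclideanLin Hᵀ z.2) := by
      simp [hU₂]
    rw [e2, e3, hV₁, hU₁, toEuclideanLin_mul, toEuclideanLin_mul, map_sub, LinearMap.sub_apply,
      toEuclideanLin_mul, map_add, map_smul]
    abel
  simp_rw [heq] at key
  rw [← hval]
  have hmeas : Measurable (fun z : EuclideanSpace ℝ (Fin n) × EuclideanSpace ℝ (Fin m) =>
      w (Matrix.toEuclideanLin A (Matrix.toEuclideanLin L z.1) + σ • z.2) -
        Matrix.toEuclideanLin B (Matrix.toEuclideanLin L z.1)) := by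
    have h1 := measurable_toEuclideanLin A
    have h2 := measurable_toEuclideanLin B
    have h3 := measurable_toEuclideanLin L
    fun_prop
  refine (ENNReal.ofReal_le_ofReal key).trans ?_
  rw [← lintegral_prod (μ := stdGaussian (EuclideanSpace ℝ (Fin n)))
    (ν := stdGaussian (EuclideanSpace ℝ (Fin m))) (f := fun z => ‖w (Matrix.toEuclideanLin A
      (Matrix.toEuclideanLin L z.1) + σ • z.2) -
        Matrix.toEuclideanLin B (Matrix.toEuclideanLin L z.1)‖ₑ ^ 2)
    (by exact (hmeas.enorm.pow_const 2).aemeasurable)]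
  have hint := (hv2.sub hUmem).norm.integrable_sq
  simp only [Pi.sub_apply, heq] at hint
  rw [ofReal_integral_eq_lintegral_ofReal hint (ae_of_all _ fun _ => sq_nonneg _)]
  refine le_of_eq (lintegral_congr fun z => ?_)
  rw [ENNReal.ofReal_pow (norm_nonneg _), ofReal_norm]

end Bayes

/-! ### Extreme eigenvalues and singular values -/

section LinearAlgebra

lemma exists_eq_mul_transpose {n : ℕ} {Q : Matrix (Fin n) (Fin n) ℝ} (hQ : Q.PosSemidef) :
    ∃ L : Matrix (Fin n) (Fin n) ℝ, Q = L * Lᵀ := by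
  open scoped MatrixOrder in
  refine ⟨CFC.sqrt Q, ?_⟩
  have h := (CFC.sqrt_nonneg Q).isSelfAdjoint
  have h' : (CFC.sqrt Q)ᵀ = CFC.sqrt Q := by
    simpa [Matrix.star_eq_conjTranspose] using h.star_eq
  rw [h', CFC.sqrt_mul_sqrt_self _ hQ.nonneg]

lemma norm_toEuclideanLin_sq_eq_dotProduct {p q : ℕ} (G : Matrix (Fin p) (Fin q) ℝ)
    (x : EuclideanSpace ℝ (Fin q)) :
    ‖Matrix.toEuclideanLin G x‖ ^ 2 = (G *ᵥ x.ofLp) ⬝ᵥ (G *ᵥ x.ofLp) := by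
  rw [EuclideanSpace.real_norm_sq_eq]
  simp [Matrix.toLpLin_apply, dotProduct, sq]

lemma norm_sq_eq_dotProduct {q : ℕ} (x : EuclideanSpace ℝ (Fin q)) :
    ‖x‖ ^ 2 = x.ofLp ⬝ᵥ x.ofLp := by
  rw [EuclideanSpace.real_norm_sq_eq]
  simp [dotProduct, sq]

lemma hasEigenvalue_toLin'_of_mulVec {n : ℕ} {M : Matrix (Fin n) (Fin n) ℝ} {μ : ℝ}
    {v : Fin n → ℝ} (hv : v ≠ 0) (h : M *ᵥ v = μ • v) :
    Module.End.HasEigenvalue (Matrix.toLin' M) μ :=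
  Module.End.hasEigenvalue_of_hasEigenvector
    ⟨Module.End.mem_eigenspace_iff.2 (by simpa using h), hv⟩

lemma exists_mulVec_eq_eigenvalues {n : ℕ} {M : Matrix (Fin n) (Fin n) ℝ} (hM : M.IsHermitian)
    (i : Fin n) : ∃ v : Fin n → ℝ, v ≠ 0 ∧ M *ᵥ v = hM.eigenvalues i • v := by
  refine ⟨(hM.eigenvectorBasis i).ofLp, ?_, by simpa using! hM.mulVec_eigenvectorBasis i⟩
  intro h
  have h2 := hM.eigenvectorBasis.orthonormal.ne_zero i
  exact h2 (by ext j; simpa using congrFun h j)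

lemma hasEigenvalue_minEigenvalue {n : ℕ} (hn : 0 < n) {M : Matrix (Fin n) (Fin n) ℝ}
    (hM : M.IsHermitian) : Module.End.HasEigenvalue (Matrix.toLin' M) (minEigenvalue M) := by
  have hne : {μ : ℝ | Module.End.HasEigenvalue (Matrix.toLin' M) μ}.Nonempty := by
    obtain ⟨v, hv, h⟩ := exists_mulVec_eq_eigenvalues hM ⟨0, hn⟩
    exact ⟨_, hasEigenvalue_toLin'_of_mulVec hv h⟩
  exact hne.csInf_mem (Module.End.finite_hasEigenvalue _)

lemma minEigenvalue_le {n : ℕ} {M : Matrix (Fin n) (Fin n) ℝ} {μ : ℝ}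
    (hμ : Module.End.HasEigenvalue (Matrix.toLin' M) μ) : minEigenvalue M ≤ μ :=
  csInf_le (Module.End.finite_hasEigenvalue _).bddBelow hμ

lemma exists_eigenvector_minEigenvalue {n : ℕ} (hn : 0 < n) {M : Matrix (Fin n) (Fin n) ℝ}
    (hM : M.IsHermitian) : ∃ e : EuclideanSpace ℝ (Fin n), ‖e‖ = 1 ∧
      e.ofLp ⬝ᵥ (M *ᵥ e.ofLp) = minEigenvalue M := by
  obtain ⟨v, hv⟩ := (hasEigenvalue_minEigenvalue hn hM).exists_hasEigenvector
  have hv1 : M *ᵥ v = minEigenvalue M • v := by simpa using hv.apply_eq_smul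
  set u : EuclideanSpace ℝ (Fin n) := WithLp.toLp 2 v with hu
  have hu0 : u ≠ 0 := fun h => hv.2 (by ext j; simpa [hu] using congrArg (fun z => z.ofLp j) h)
  have hun : ‖u‖ ≠ 0 := norm_ne_zero_iff.2 hu0
  refine ⟨‖u‖⁻¹ • u, by rw [norm_smul, norm_inv, norm_norm, inv_mul_cancel₀ hun], ?_⟩
  have hd : v ⬝ᵥ v = ‖u‖ ^ 2 := (norm_sq_eq_dotProduct u).symm
  have hou : u.ofLp = v := rfl
  simp only [hou, WithLp.ofLp_smul, Matrix.mulVec_smul, hv1, smul_dotProduct, dotProduct_smul,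
    smul_eq_mul, hd]
  field_simp

lemma minEigenvalue_mul_norm_sq_le {n : ℕ} {M : Matrix (Fin n) (Fin n) ℝ}
    (hM : M.IsHermitian) (x : EuclideanSpace ℝ (Fin n)) :
    minEigenvalue M * ‖x‖ ^ 2 ≤ x.ofLp ⬝ᵥ (M *ᵥ x.ofLp) := by
  set κ := minEigenvalue M
  have hN : (M - κ • (1 : Matrix (Fin n) (Fin n) ℝ)).IsHermitian :=
    hM.sub (by simp [Matrix.IsHermitian])
  have hpsd : (M - κ • (1 : Matrix (Fin n) (Fin n) ℝ)).PosSemidef := by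
    rw [hN.posSemidef_iff_eigenvalues_nonneg]
    intro i
    obtain ⟨v, hv, h⟩ := exists_mulVec_eq_eigenvalues hN i
    rw [Matrix.sub_mulVec, Matrix.smul_mulVec, Matrix.one_mulVec, sub_eq_iff_eq_add,
      ← add_smul] at h
    have := minEigenvalue_le (hasEigenvalue_toLin'_of_mulVec hv h)
    change 0 ≤ hN.eigenvalues i
    linarith
  have := hpsd.dotProduct_mulVec_nonneg x.ofLp
  simp only [star_trivial, Matrix.sub_mulVec, Matrix.smul_mulVec, Matrix.one_mulVec,
    dotProduct_sub, dotProduct_smul, smul_eq_mul] at this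
  rw [norm_sq_eq_dotProduct]
  linarith

lemma minEigenvalue_pos {n : ℕ} (hn : 0 < n) {M : Matrix (Fin n) (Fin n) ℝ} (hM : M.PosDef) :
    0 < minEigenvalue M := by
  obtain ⟨e, he, h⟩ := exists_eigenvector_minEigenvalue hn hM.isHermitian
  rw [← h]
  have he0 : e.ofLp ≠ 0 := fun h0 => by
    have : e = 0 := by ext j; simpa using congrFun h0 j
    simp [this] at he
  simpa using hM.dotProduct_mulVec_pos he0

section SingularValues

variable {E F : Type*} [NormedAddCommGroup E] [InnerProductSpace ℝ E] [FiniteDimensional ℝ E]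
  [NormedAddCommGroup F] [InnerProductSpace ℝ F] [FiniteDimensional ℝ F] (T : E →ₗ[ℝ] F)

/-- The form ‖Tx‖² is diagonal in an orthonormal eigenbasis of T*T. Comparing its coefficients with
the extreme ones gives the two norm bounds that link `condB` to the problem. -/
lemma norm_sq_apply_eq_sum_singularValues (x : E) :
    ‖T x‖ ^ 2 = ∑ i : Fin (Module.finrank ℝ E), T.singularValues i ^ 2 *
      ((T.isSymmetric_adjoint_comp_self.eigenvectorBasis rfl).repr x i) ^ 2 := by
  set b := T.isSymmetric_adjoint_comp_self.eigenvectorBasis (rfl : Module.finrank ℝ E = _)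
  have h1 : ‖T x‖ ^ 2 = inner ℝ x ((LinearMap.adjoint T ∘ₗ T) x) := by
    rw [LinearMap.comp_apply, LinearMap.adjoint_inner_right, real_inner_self_eq_norm_sq]
  rw [h1, ← b.repr.inner_map_map, PiLp.inner_apply]
  refine Finset.sum_congr rfl fun i _ => ?_
  rw [T.sq_singularValues_fin rfl i]
  have := T.isSymmetric_adjoint_comp_self.eigenvectorBasis_apply_self_apply rfl x i
  simp only [b, this]
  simp
  ring

lemma norm_sq_eq_sum_repr_sq (x : E) : ‖x‖ ^ 2 = ∑ i : Fin (Module.finrank ℝ E),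
      ((T.isSymmetric_adjoint_comp_self.eigenvectorBasis rfl).repr x i) ^ 2 := by
  rw [← EuclideanSpace.real_norm_sq_eq, LinearIsometryEquiv.norm_map]

lemma norm_apply_le_singularValues_zero (x : E) : ‖T x‖ ≤ T.singularValues 0 * ‖x‖ := by
  refine le_of_sq_le_sq ?_ (mul_nonneg (T.singularValues_nonneg 0) (norm_nonneg _))
  rw [mul_pow, norm_sq_apply_eq_sum_singularValues, norm_sq_eq_sum_repr_sq T, Finset.mul_sum]
  gcongr with i
  · exact T.singularValues_nonneg _
  · exact T.singularValues_antitone (Nat.zero_le _)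

lemma singularValues_last_mul_norm_le (x : E) :
    T.singularValues (Module.finrank ℝ E - 1) * ‖x‖ ≤ ‖T x‖ := by
  refine le_of_sq_le_sq ?_ (norm_nonneg _)
  rw [mul_pow, norm_sq_apply_eq_sum_singularValues, norm_sq_eq_sum_repr_sq T, Finset.mul_sum]
  gcongr with i
  · exact T.singularValues_nonneg _
  · exact T.singularValues_antitone (by omega)

end SingularValues

end LinearAlgebra

/-! ### Feasibility, existence of an optimal solution, bounds on the objective -/

section Ellitopes

variable {m n ν K : ℕ} {A : Matrix (Fin m) (Fin n) ℝ} {B : Matrix (Fin ν) (Fin n) ℝ} {σ : ℝ}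
  {S : Fin K → Matrix (Fin n) (Fin n) ℝ} {T : Set (Fin K → ℝ)}

lemma dotProduct_sum_mulVec (x : Fin n → ℝ) :
    x ⬝ᵥ ((∑ k, S k) *ᵥ x) = ∑ k, x ⬝ᵥ (S k *ᵥ x) := by
  rw [Matrix.sum_mulVec, dotProduct_sum]

namespace IsEllitopeData

lemma le_supportFn (hd : IsEllitopeData S T) (lam : Fin K → ℝ) {t : Fin K → ℝ} (ht : t ∈ T) :
    lam ⬝ᵥ t ≤ supportFn T lam := by
  have hc : Continuous fun t : Fin K → ℝ => lam ⬝ᵥ t := by unfold dotProduct; fun_prop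
  exact le_csSup (hd.isCompact.image hc).bddAbove ⟨t, ht, rfl⟩

lemma supportFn_le (hd : IsEllitopeData S T) {lam : Fin K → ℝ} {c : ℝ}
    (h : ∀ t ∈ T, lam ⬝ᵥ t ≤ c) : supportFn T lam ≤ c := by
  obtain ⟨t, ht, -⟩ := hd.exists_pos
  refine csSup_le ⟨_, t, ht, rfl⟩ ?_
  rintro _ ⟨t, ht, rfl⟩
  exact h t ht

lemma supportFn_nonneg (hd : IsEllitopeData S T) {lam : Fin K → ℝ} (h : 0 ≤ lam) :
    0 ≤ supportFn T lam := by
  obtain ⟨t, ht, -⟩ := hd.exists_pos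
  exact (dotProduct_nonneg_of_nonneg h (hd.nonneg t ht)).trans (hd.le_supportFn lam ht)

lemma sum_le_sizeT (hd : IsEllitopeData S T) {t : Fin K → ℝ} (ht : t ∈ T) :
    ∑ k, t k ≤ sizeT T := by
  have hc : Continuous fun t : Fin K → ℝ => ∑ k, t k := by fun_prop
  exact le_csSup (hd.isCompact.image hc).bddAbove ⟨t, ht, rfl⟩

lemma dotProduct_mulVec_nonneg (hd : IsEllitopeData S T) (k : Fin K) (x : Fin n → ℝ) :
    0 ≤ x ⬝ᵥ (S k *ᵥ x) := by
  simpa using (hd.posSemidef k).dotProduct_mulVec_nonneg x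

lemma card_pos (hd : IsEllitopeData S T) (hn : 0 < n) : 0 < K := by
  rcases Nat.eq_zero_or_pos K with h | h
  · subst h
    have h1 := hd.sum_posDef.diag_pos (i := (⟨0, hn⟩ : Fin n))
    simp at h1
  · exact h

lemma sizeT_pos (hd : IsEllitopeData S T) (hn : 0 < n) : 0 < sizeT T := by
  obtain ⟨t, ht, hpos⟩ := hd.exists_pos
  have : Nonempty (Fin K) := ⟨⟨0, hd.card_pos hn⟩⟩
  exact (Finset.sum_pos (fun k _ => hpos k) Finset.univ_nonempty).trans_le (hd.sum_le_sizeT ht)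

lemma norm_sq_le (hd : IsEllitopeData S T) (hn : 0 < n) {x : EuclideanSpace ℝ (Fin n)}
    (hx : x ∈ ellitope S T) : ‖x‖ ^ 2 ≤ sizeT T / minEigenvalue (∑ k, S k) := by
  obtain ⟨t, ht, hxt⟩ := hx
  rw [le_div_iff₀ (minEigenvalue_pos hn hd.sum_posDef), mul_comm]
  refine (minEigenvalue_mul_norm_sq_le hd.sum_posDef.isHermitian x).trans ?_
  rw [dotProduct_sum_mulVec]
  exact (Finset.sum_le_sum fun k _ => hxt k).trans (hd.sum_le_sizeT ht)

end IsEllitopeData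

lemma isFeasible_iff (hd : IsEllitopeData S T) {H : Matrix (Fin m) (Fin ν) ℝ}
    {lam : Fin K → ℝ} : IsFeasible A B S H lam ↔ 0 ≤ lam ∧ ∀ x : Fin n → ℝ,
      ((B - Hᵀ * A) *ᵥ x) ⬝ᵥ ((B - Hᵀ * A) *ᵥ x) ≤ ∑ k, lam k * (x ⬝ᵥ (S k *ᵥ x)) := by
  have hherm : (∑ k, lam k • S k - (B - Hᵀ * A)ᵀ * (B - Hᵀ * A)).IsHermitian := by
    refine Matrix.IsHermitian.sub ?_ (by
      simpa using Matrix.isHermitian_conjTranspose_mul_self (B - Hᵀ * A))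
    simp only [Matrix.IsHermitian, Matrix.conjTranspose_sum, Matrix.conjTranspose_smul,
      (hd.posSemidef _).isHermitian.eq, star_trivial]
  have hq : ∀ x : Fin n → ℝ, star x ⬝ᵥ
      ((∑ k, lam k • S k - (B - Hᵀ * A)ᵀ * (B - Hᵀ * A)) *ᵥ x) =
      ∑ k, lam k * (x ⬝ᵥ (S k *ᵥ x)) - ((B - Hᵀ * A) *ᵥ x) ⬝ᵥ ((B - Hᵀ * A) *ᵥ x) := by
    intro x
    rw [star_trivial, Matrix.sub_mulVec, dotProduct_sub, Matrix.sum_mulVec, dotProduct_sum,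
      ← Matrix.mulVec_mulVec, Matrix.mulVec_transpose, dotProduct_comm x (_ ᵥ* _),
      ← Matrix.dotProduct_mulVec]
    simp [Matrix.smul_mulVec]
  rw [IsFeasible, Matrix.posSemidef_iff_dotProduct_mulVec]
  simp only [hq, hherm, true_and, sub_nonneg]

lemma IsFeasible.norm_sq_le (hd : IsEllitopeData S T) {H : Matrix (Fin m) (Fin ν) ℝ}
    {lam : Fin K → ℝ} (hf : IsFeasible A B S H lam) (x : EuclideanSpace ℝ (Fin n)) :
    ‖Matrix.toEuclideanLin (B - Hᵀ * A) x‖ ^ 2 ≤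
      ∑ k, lam k * (x.ofLp ⬝ᵥ (S k *ᵥ x.ofLp)) := by
  rw [norm_toEuclideanLin_sq_eq_dotProduct]
  exact ((isFeasible_iff hd).1 hf).2 _

lemma trace_transpose_mul_self_nonneg (H : Matrix (Fin m) (Fin ν) ℝ) : 0 ≤ (Hᵀ * H).trace := by
  simpa using trace_mul_transpose_nonneg Hᵀ

/-- The noise is centered, so the mean loss at x is exactly ‖(B - HᵀA)x‖² + σ² Tr(HᵀH). Feasibility
bounds the bias term by ∑ λ_k xᵀS_k x ≤ λᵀt ≤ φ(λ). -/
lemma IsFeasible.risk_le (hd : IsEllitopeData S T) {H : Matrix (Fin m) (Fin ν) ℝ}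
    {lam : Fin K → ℝ} (hf : IsFeasible A B S H lam) :
    risk A B σ (ellitope S T) (linearEstimate H) ≤ ENNReal.ofReal √(objective σ T H lam) := by
  refine iSup₂_le fun x hx => ?_
  have h1 : ∀ ξ : EuclideanSpace ℝ (Fin m),
      linearEstimate H (Matrix.toEuclideanLin A x + σ • ξ) - Matrix.toEuclideanLin B x =
      -Matrix.toEuclideanLin (B - Hᵀ * A) x + Matrix.toEuclideanLin (σ • Hᵀ) ξ := by
    intro ξ
    rw [linearEstimate, map_sub, LinearMap.sub_apply, toEuclideanLin_mul, map_add, map_smul,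
      map_smul, LinearMap.smul_apply]
    abel
  have h2 : ∫⁻ ξ, ‖linearEstimate H (Matrix.toEuclideanLin A x + σ • ξ) -
      Matrix.toEuclideanLin B x‖ₑ ^ 2 ∂(stdGaussian (EuclideanSpace ℝ (Fin m))) =
      ENNReal.ofReal (‖Matrix.toEuclideanLin (B - Hᵀ * A) x‖ ^ 2 + σ ^ 2 * (Hᵀ * H).trace) := by
    have h3 := integral_norm_add_toEuclideanLin_sq (-Matrix.toEuclideanLin (B - Hᵀ * A) x)
      (σ • Hᵀ)
    have h4 : ((σ • Hᵀ) * (σ • Hᵀ)ᵀ).trace = σ ^ 2 * (Hᵀ * H).trace := by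
      simp [smul_smul, sq]
    rw [norm_neg, h4] at h3
    rw [← h3, ofReal_integral_eq_lintegral_ofReal (integrable_norm_add_toEuclideanLin_sq _ _)
      (ae_of_all _ fun _ => sq_nonneg _)]
    refine lintegral_congr fun ξ => ?_
    rw [h1, ENNReal.ofReal_pow (norm_nonneg _), ofReal_norm]
  obtain ⟨t, ht, hxt⟩ := hx
  have h5 : ‖Matrix.toEuclideanLin (B - Hᵀ * A) x‖ ^ 2 + σ ^ 2 * (Hᵀ * H).trace ≤
      objective σ T H lam := by
    rw [objective, add_comm]
    gcongr
    refine (hf.norm_sq_le hd x).trans (le_trans ?_ (hd.le_supportFn lam ht))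
    exact Finset.sum_le_sum fun k _ => mul_le_mul_of_nonneg_left (hxt k) (hf.1 k)
  rw [h2, ENNReal.ofReal_rpow_of_nonneg (add_nonneg (sq_nonneg _)
    (mul_nonneg (sq_nonneg _) (trace_transpose_mul_self_nonneg H))) (by norm_num), ← Real.sqrt_eq_rpow]
  exact ENNReal.ofReal_le_ofReal (Real.sqrt_le_sqrt h5)

lemma exists_isFeasible (hd : IsEllitopeData S T) (hn : 0 < n) (A : Matrix (Fin m) (Fin n) ℝ)
    (B : Matrix (Fin ν) (Fin n) ℝ) :
    ∃ (H : Matrix (Fin m) (Fin ν) ℝ) (lam : Fin K → ℝ), IsFeasible A B S H lam := by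
  have hκ := minEigenvalue_pos hn hd.sum_posDef
  set κ := minEigenvalue (∑ k, S k)
  -- Here ‖Bx‖² ≤ Tr(BBᵀ)‖x‖² and κ‖x‖² ≤ ∑ xᵀS_k x.
  refine ⟨0, fun _ => (B * Bᵀ).trace / κ, (isFeasible_iff hd).2 ⟨fun _ =>
    div_nonneg (trace_mul_transpose_nonneg B) hκ.le, fun x => ?_⟩⟩
  rw [← Finset.mul_sum, ← dotProduct_sum_mulVec]
  have h1 := minEigenvalue_mul_norm_sq_le hd.sum_posDef.isHermitian (WithLp.toLp 2 x)
  have h2 := norm_toEuclideanLin_sq_le B (WithLp.toLp 2 x)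
  rw [norm_toEuclideanLin_sq_eq_dotProduct] at h2
  simp only [Matrix.transpose_zero, Matrix.zero_mul, sub_zero]
  refine h2.trans ?_
  rw [div_mul_eq_mul_div, le_div_iff₀ hκ, mul_assoc, mul_comm _ κ]
  exact mul_le_mul_of_nonneg_left h1 (trace_mul_transpose_nonneg B)

lemma isClosed_setOf_isFeasible (hd : IsEllitopeData S T) (A : Matrix (Fin m) (Fin n) ℝ)
    (B : Matrix (Fin ν) (Fin n) ℝ) :
    IsClosed {z : Matrix (Fin m) (Fin ν) ℝ × (Fin K → ℝ) | IsFeasible A B S z.1 z.2} := by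
  simp only [isFeasible_iff hd, Set.ofPred_and, Set.ofPred_forall]
  refine (isClosed_le continuous_const continuous_snd).inter (isClosed_iInter fun x => ?_)
  refine isClosed_le ?_ (by fun_prop)
  have : Continuous fun z : Matrix (Fin m) (Fin ν) ℝ × (Fin K → ℝ) => (B - z.1ᵀ * A) *ᵥ x :=
    (continuous_const.sub (continuous_fst.matrix_transpose.matrix_mul
      continuous_const)).matrix_mulVec continuous_const
  exact this.dotProduct this

/-- The support function is a supremum of linear functions, so sublevel sets are intersections of
closed sets. -/
lemma lowerSemicontinuous_objective (hd : IsEllitopeData S T) (σ : ℝ) :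
    LowerSemicontinuous fun z : Matrix (Fin m) (Fin ν) ℝ × (Fin K → ℝ) =>
      objective σ T z.1 z.2 := by
  rw [lowerSemicontinuous_iff_isClosed_preimage]
  intro c
  have : (fun z : Matrix (Fin m) (Fin ν) ℝ × (Fin K → ℝ) => objective σ T z.1 z.2) ⁻¹' Set.Iic c =
      ⋂ t ∈ T, {z | σ ^ 2 * (z.1ᵀ * z.1).trace + z.2 ⬝ᵥ t ≤ c} := by
    ext z
    simp only [Set.mem_preimage, Set.mem_Iic, Set.mem_iInter, Set.mem_ofPred_eq, objective]
    constructor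
    · intro h t ht
      linarith [hd.le_supportFn z.2 ht]
    · intro h
      have := hd.supportFn_le (lam := z.2) (c := c - σ ^ 2 * (z.1ᵀ * z.1).trace)
        fun t ht => by linarith [h t ht]
      linarith
  rw [this]
  refine isClosed_biInter fun t _ => isClosed_le (Continuous.add (continuous_const.mul
    (continuous_fst.matrix_transpose.matrix_mul continuous_fst).matrix_trace) ?_) continuous_const
  exact continuous_snd.dotProduct continuous_const

/-- Feasible points in a sublevel set are bounded: σ > 0 controls `H`, and a strictly positive t ∈ 𝒯
controls `λ` through λ_k t_k ≤ φ(λ). -/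
lemma exists_isOptimalSolution (hd : IsEllitopeData S T) (hn : 0 < n) (hσ : 0 < σ)
    (A : Matrix (Fin m) (Fin n) ℝ) (B : Matrix (Fin ν) (Fin n) ℝ) :
    ∃ (H : Matrix (Fin m) (Fin ν) ℝ) (lam : Fin K → ℝ), IsOptimalSolution A B σ S T H lam := by
  obtain ⟨H₀, lam₀, hf₀⟩ := exists_isFeasible hd hn A B
  obtain ⟨t, ht, htpos⟩ := hd.exists_pos
  set c := objective σ T H₀ lam₀ with hc
  set box : Set (Matrix (Fin m) (Fin ν) ℝ × (Fin K → ℝ)) :=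
    (Set.pi Set.univ fun _ => Set.pi Set.univ fun _ =>
      Set.Icc (-(c / σ ^ 2 + 1)) (c / σ ^ 2 + 1)) ×ˢ
      (Set.pi Set.univ fun k => Set.Icc 0 (c / t k)) with hbox
  have hboxc : IsCompact box :=
    (isCompact_univ_pi fun _ => isCompact_univ_pi fun _ => isCompact_Icc).prod
      (isCompact_univ_pi fun _ => isCompact_Icc)
  have hmem : ∀ z : Matrix (Fin m) (Fin ν) ℝ × (Fin K → ℝ), IsFeasible A B S z.1 z.2 →
      objective σ T z.1 z.2 ≤ c → z ∈ box := by
    rintro ⟨H, lam⟩ hf hle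
    have htr := trace_transpose_mul_self_nonneg H
    have hs := hd.supportFn_nonneg hf.1
    have hdot := hd.le_supportFn lam ht
    simp only [objective] at hle
    have h1 : (Hᵀ * H).trace ≤ c / σ ^ 2 := by
      rw [le_div_iff₀ (by positivity)]; nlinarith
    refine ⟨fun i _ j _ => ?_, fun k _ => ⟨hf.1 k, ?_⟩⟩
    · have h2 : H i j ^ 2 ≤ (Hᵀ * H).trace := by
        simp only [Matrix.trace, Matrix.diag_apply, Matrix.mul_apply, Matrix.transpose_apply, ← sq]
        exact (Finset.single_le_sum (f := fun i => H i j ^ 2) (fun _ _ => sq_nonneg _)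
          (Finset.mem_univ i)).trans (Finset.single_le_sum (f := fun j => ∑ i, H i j ^ 2)
          (fun _ _ => Finset.sum_nonneg fun _ _ => sq_nonneg _) (Finset.mem_univ j))
      -- The radius c/σ² + 1 of the box comes from |h| ≤ h² + 1.
      constructor <;> nlinarith [sq_nonneg (H i j - 1), sq_nonneg (H i j + 1)]
    · rw [le_div_iff₀ (htpos k)]
      have h3 : lam k * t k ≤ lam ⬝ᵥ t :=
        Finset.single_le_sum (f := fun k => lam k * t k)
          (fun k _ => mul_nonneg (hf.1 k) (htpos k).le) (Finset.mem_univ k)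
      nlinarith [mul_nonneg (sq_nonneg σ) htr]
  have hcomp : IsCompact (box ∩ {z | IsFeasible A B S z.1 z.2}) :=
    hboxc.inter_right (isClosed_setOf_isFeasible hd A B)
  have hne : (box ∩ {z | IsFeasible A B S z.1 z.2}).Nonempty :=
    ⟨(H₀, lam₀), hmem _ hf₀ le_rfl, hf₀⟩
  obtain ⟨z, hz, hmin⟩ := ((lowerSemicontinuous_objective (m := m) (ν := ν) hd
    σ).lowerSemicontinuousOn _).exists_isMinOn hne hcomp
  refine ⟨z.1, z.2, hz.2, fun H' lam' hf' => ?_⟩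
  have h0 : objective σ T z.1 z.2 ≤ c := hmin (a := (H₀, lam₀)) ⟨hmem _ hf₀ le_rfl, hf₀⟩
  rcases le_total (objective σ T H' lam') c with h | h
  · exact hmin (a := (H', lam')) ⟨hmem _ hf' h, hf'⟩
  · exact h0.trans h

/-- A lower bound on the objective, obtained by testing feasibility on a bottom eigenvector of
`∑ S_k`. -/
lemma IsFeasible.sq_le_objective (hd : IsEllitopeData S T) (hn : 0 < n) (hσ : 0 < σ)
    {H : Matrix (Fin m) (Fin ν) ℝ} {lam : Fin K → ℝ} (hf : IsFeasible A B S H lam)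
    {β s : ℝ} (hβ : 0 < β) (hB : ∀ x, β * ‖x‖ ≤ ‖Matrix.toEuclideanLin B x‖)
    {t : Fin K → ℝ} (ht : t ∈ T) (hs : 0 < s) (hst : ∀ k, s ≤ t k) :
    β ^ 2 / 4 ≤ (minEigenvalue (∑ k, S k) / s + specNorm A ^ 2 / σ ^ 2) *
      objective σ T H lam := by
  have hκ := minEigenvalue_pos hn hd.sum_posDef
  obtain ⟨e, he, heS⟩ := exists_eigenvector_minEigenvalue hn hd.sum_posDef.isHermitian
  set κ := minEigenvalue (∑ k, S k)
  have htr := trace_transpose_mul_self_nonneg H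
  have hsup := hd.supportFn_nonneg hf.1
  have hobj : 0 ≤ objective σ T H lam := add_nonneg (mul_nonneg (sq_nonneg _) htr) hsup
  have hBe := hB e
  rw [he, mul_one] at hBe
  have hdec : Matrix.toEuclideanLin B e = Matrix.toEuclideanLin (B - Hᵀ * A) e +
      Matrix.toEuclideanLin Hᵀ (Matrix.toEuclideanLin A e) := by
    rw [map_sub, LinearMap.sub_apply, toEuclideanLin_mul]; abel
  have htri : β ≤ ‖Matrix.toEuclideanLin (B - Hᵀ * A) e‖ +
      ‖Matrix.toEuclideanLin Hᵀ (Matrix.toEuclideanLin A e)‖ := by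
    rw [hdec] at hBe
    exact hBe.trans (norm_add_le _ _)
  rw [add_mul]
  -- One of the two parts of Be has norm at least β/2. A large bias forces `λ` to be large, since
  -- eᵀS_k e ≤ κ for each k and s ∑ λ_k ≤ φ(λ); a large HᵀAe forces Tr(HᵀH) to be large.
  rcases le_total (β / 2) ‖Matrix.toEuclideanLin (B - Hᵀ * A) e‖ with h | h
  · have h1 : (β / 2) ^ 2 ≤ ‖Matrix.toEuclideanLin (B - Hᵀ * A) e‖ ^ 2 := by gcongr
    have h2 : ∑ k, lam k * (e.ofLp ⬝ᵥ (S k *ᵥ e.ofLp)) ≤ ∑ k, lam k * κ := by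
      refine Finset.sum_le_sum fun k _ => mul_le_mul_of_nonneg_left ?_ (hf.1 k)
      rw [← heS, dotProduct_sum_mulVec]
      exact Finset.single_le_sum (f := fun k => e.ofLp ⬝ᵥ (S k *ᵥ e.ofLp))
        (fun k _ => hd.dotProduct_mulVec_nonneg k _) (Finset.mem_univ k)
    have h3 : (∑ k, lam k) * s ≤ objective σ T H lam := by
      have : (∑ k, lam k) * s ≤ lam ⬝ᵥ t := by
        rw [Finset.sum_mul]
        exact Finset.sum_le_sum fun k _ => mul_le_mul_of_nonneg_left (hst k) (hf.1 k)
      have := hd.le_supportFn lam ht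
      have := mul_nonneg (sq_nonneg σ) htr
      rw [objective]; linarith
    have h4 := hf.norm_sq_le hd e
    have h5 : β ^ 2 / 4 ≤ κ / s * objective σ T H lam := by
      have : ∑ k, lam k ≤ objective σ T H lam / s := by rwa [le_div_iff₀ hs]
      calc β ^ 2 / 4 = (β / 2) ^ 2 := by ring
        _ ≤ (∑ k, lam k) * κ := by rw [Finset.sum_mul]; linarith
        _ ≤ objective σ T H lam / s * κ := by gcongr
        _ = _ := by ring
    have h6 : 0 ≤ specNorm A ^ 2 / σ ^ 2 * objective σ T H lam := by positivity
    linarith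
  · have h1 : β / 2 ≤ ‖Matrix.toEuclideanLin Hᵀ (Matrix.toEuclideanLin A e)‖ := by linarith
    have h2 := norm_toEuclideanLin_sq_le Hᵀ (Matrix.toEuclideanLin A e)
    have h3 : ‖Matrix.toEuclideanLin A e‖ ≤ specNorm A := by
      simpa [he, specNorm] using (LinearMap.toContinuousLinearMap (Matrix.toEuclideanLin A)).le_opNorm e
    rw [Matrix.transpose_transpose] at h2
    have h4 : (Hᵀ * H).trace ≤ objective σ T H lam / σ ^ 2 := by
      rw [le_div_iff₀ (by positivity), objective]; linarith
    have h5 : β ^ 2 / 4 ≤ specNorm A ^ 2 / σ ^ 2 * objective σ T H lam := by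
      calc β ^ 2 / 4 = (β / 2) ^ 2 := by ring
        _ ≤ ‖Matrix.toEuclideanLin Hᵀ (Matrix.toEuclideanLin A e)‖ ^ 2 := by gcongr
        _ ≤ (Hᵀ * H).trace * ‖Matrix.toEuclideanLin A e‖ ^ 2 := h2
        _ ≤ objective σ T H lam / σ ^ 2 * specNorm A ^ 2 := by gcongr
        _ = _ := by ring
    have h6 : 0 ≤ κ / s * objective σ T H lam := by positivity
    linarith

end Ellitopes

/-! ### Minimax theorem and convexity of trace forms -/

section Minimax

/-- A minimax theorem with one compact side, for functions continuous in each variable. -/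
lemma exists_forall_lt_of_convexOn_of_concaveOn {E F : Type*}
    [TopologicalSpace E] [AddCommGroup E] [Module ℝ E] [IsTopologicalAddGroup E]
    [ContinuousSMul ℝ E] [TopologicalSpace F] [AddCommGroup F] [Module ℝ F]
    [IsTopologicalAddGroup F] [ContinuousSMul ℝ F] {X : Set E} {Y : Set F} {f : E → F → ℝ}
    (hne : X.Nonempty) (hX : IsCompact X) (hfy : ∀ y, Continuous fun x => f x y)
    (hfx : ∀ x, Continuous (f x)) (hconv : ∀ y ∈ Y, ConvexOn ℝ X fun x => f x y)
    (hconc : ∀ x ∈ X, ConcaveOn ℝ Y (f x)) {c : ℝ}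
    (h : ∀ x ∈ X, ∃ y ∈ Y, c < f x y) : ∃ y ∈ Y, ∀ x ∈ X, c < f x y := by
  classical
  obtain ⟨x₀, hx₀⟩ := hne
  obtain ⟨y₀, hy₀, -⟩ := h x₀ hx₀
  choose! g hgY hg using h
  -- By compactness finitely many of the responses `g x` already beat `c` at every point of `X`,
  -- which is the finite form of the hypothesis in Sion's theorem.
  obtain ⟨s, hsX, hs⟩ := hX.elim_nhds_subcover (fun x => {x' | c < f x' (g x)})
    fun x hx => (isOpen_lt continuous_const (hfy (g x))).mem_nhds (hg x hx)
  refine Sion.exists_lt_iInf_of_lt_iInf_of_finite ⟨x₀, hx₀⟩ hX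
    (fun y _ => (hfy y).lowerSemicontinuous.lowerSemicontinuousOn _)
    (fun y hy => (hconv y hy).quasiconvexOn) (hconc x₀ hx₀).1
    (fun x _ => (hfx x).upperSemicontinuous.upperSemicontinuousOn _)
    (fun x hx => (hconc x hx).quasiconcaveOn) (hconv y₀ hy₀).1
    (s := (s.image g : Set F)) (Finset.finite_toSet _) ?_ fun x hx => ?_
  · intro y hy
    obtain ⟨x, hx, rfl⟩ := Finset.mem_image.1 (Finset.mem_coe.1 hy)
    exact hgY x (hsX x hx)
  · obtain ⟨x', hx', hlt⟩ := Set.mem_iUnion₂.1 (hs hx)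
    exact ⟨g x', Finset.mem_coe.2 (Finset.mem_image_of_mem g hx'), hlt⟩

lemma trace_mul_mul_transpose_nonneg {p q : ℕ} {Q : Matrix (Fin q) (Fin q) ℝ}
    (hQ : Q.PosSemidef) (D : Matrix (Fin p) (Fin q) ℝ) : 0 ≤ (D * Q * Dᵀ).trace := by
  simpa using (hQ.mul_mul_conjTranspose_same D).trace_nonneg

/-- For the quadratic form q(M) = Tr(MQMᵀ) the gap between the two sides is ab q(M - N) ≥ 0. -/
lemma trace_mul_mul_transpose_convex {p q : ℕ} {Q : Matrix (Fin q) (Fin q) ℝ}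
    (hQ : Q.PosSemidef) (M N : Matrix (Fin p) (Fin q) ℝ) {a b : ℝ} (ha : 0 ≤ a) (hb : 0 ≤ b)
    (hab : a + b = 1) :
    ((a • M + b • N) * Q * (a • M + b • N)ᵀ).trace ≤
      a * (M * Q * Mᵀ).trace + b * (N * Q * Nᵀ).trace := by
  have h := mul_nonneg (mul_nonneg ha hb) (trace_mul_mul_transpose_nonneg hQ (M - N))
  obtain rfl : b = 1 - a := by linarith
  simp only [Matrix.transpose_add, Matrix.transpose_sub, Matrix.transpose_smul, Matrix.add_mul,
    Matrix.mul_add, Matrix.sub_mul, Matrix.mul_sub, Matrix.trace_add, Matrix.trace_sub,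
    Matrix.smul_mul, Matrix.mul_smul, Matrix.trace_smul, smul_eq_mul] at h ⊢
  nlinarith

end Minimax

/-! ### Lagrangian duality and the least favourable covariance -/

section Duality

variable {m n ν K : ℕ} {A : Matrix (Fin m) (Fin n) ℝ} {B : Matrix (Fin ν) (Fin n) ℝ} {σ : ℝ}
  {S : Fin K → Matrix (Fin n) (Fin n) ℝ} {T : Set (Fin K → ℝ)}

/-- The Lagrange function of the optimization problem, with dual variables `(Q, t)`. -/
def lagrangian (A : Matrix (Fin m) (Fin n) ℝ) (B : Matrix (Fin ν) (Fin n) ℝ) (σ : ℝ)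
    (S : Fin K → Matrix (Fin n) (Fin n) ℝ) (z : Matrix (Fin n) (Fin n) ℝ × (Fin K → ℝ))
    (y : Matrix (Fin m) (Fin ν) ℝ × (Fin K → ℝ)) : ℝ :=
  σ ^ 2 * (y.1ᵀ * y.1).trace + ((B - y.1ᵀ * A) * z.1 * (B - y.1ᵀ * A)ᵀ).trace +
    ∑ k, y.2 k * (z.2 k - (S k * z.1).trace)

lemma continuous_lagrangian_left (y : Matrix (Fin m) (Fin ν) ℝ × (Fin K → ℝ)) :
    Continuous fun z => lagrangian A B σ S z y := by
  unfold lagrangian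
  refine (continuous_const.add ((continuous_const.matrix_mul continuous_fst).matrix_mul
    continuous_const).matrix_trace).add (continuous_finsetSum _ fun k _ => continuous_const.mul ?_)
  exact ((continuous_apply k).comp continuous_snd).sub
    (continuous_const.matrix_mul continuous_fst).matrix_trace

lemma continuous_lagrangian_right (z : Matrix (Fin n) (Fin n) ℝ × (Fin K → ℝ)) :
    Continuous (lagrangian A B σ S z) := by
  unfold lagrangian
  have h : Continuous fun y : Matrix (Fin m) (Fin ν) ℝ × (Fin K → ℝ) => B - y.1ᵀ * A :=
    continuous_const.sub (continuous_fst.matrix_transpose.matrix_mul continuous_const)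
  refine ((continuous_const.mul (continuous_fst.matrix_transpose.matrix_mul
    continuous_fst).matrix_trace).add ((h.matrix_mul continuous_const).matrix_mul
    h.matrix_transpose).matrix_trace).add (continuous_finsetSum _ fun k _ => ?_)
  exact ((continuous_apply k).comp continuous_snd).mul continuous_const

lemma convexOn_lagrangian {z : Matrix (Fin n) (Fin n) ℝ × (Fin K → ℝ)} (hz : z.1.PosSemidef)
    {Y : Set (Matrix (Fin m) (Fin ν) ℝ × (Fin K → ℝ))} (hY : Convex ℝ Y) :
    ConvexOn ℝ Y (lagrangian A B σ S z) := by
  refine ⟨hY, fun y _ y' _ a b ha hb hab => ?_⟩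
  have h1 := trace_mul_mul_transpose_convex (Matrix.PosSemidef.one (n := Fin m) (R := ℝ)) y.1ᵀ y'.1ᵀ
    ha hb hab
  have h2 := trace_mul_mul_transpose_convex hz (B - y.1ᵀ * A) (B - y'.1ᵀ * A) ha hb hab
  have e1 : a • y.1ᵀ + b • y'.1ᵀ = (a • y.1 + b • y'.1)ᵀ := by simp
  have e2 : a • (B - y.1ᵀ * A) + b • (B - y'.1ᵀ * A) = B - (a • y.1 + b • y'.1)ᵀ * A := by
    have : B = a • B + b • B := by rw [← add_smul, hab, one_smul]
    conv_rhs => rw [this]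
    simp only [Matrix.transpose_add, Matrix.transpose_smul, Matrix.add_mul, Matrix.smul_mul,
      smul_sub]
    abel
  rw [e1] at h1
  rw [e2] at h2
  simp only [Matrix.mul_one, Matrix.transpose_transpose] at h1
  have h3 : ∑ k, (a • y + b • y').2 k * (z.2 k - (S k * z.1).trace) =
      a * ∑ k, y.2 k * (z.2 k - (S k * z.1).trace) +
        b * ∑ k, y'.2 k * (z.2 k - (S k * z.1).trace) := by
    rw [Finset.mul_sum, Finset.mul_sum, ← Finset.sum_add_distrib]
    refine Finset.sum_congr rfl fun k _ => ?_
    simp only [Prod.snd_add, Prod.smul_snd, Pi.add_apply, Pi.smul_apply, smul_eq_mul]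
    ring
  have h4 := mul_le_mul_of_nonneg_left h1 (sq_nonneg σ)
  simp only [lagrangian, h3, smul_eq_mul, Prod.fst_add, Prod.smul_fst]
  linarith

lemma lagrangian_affine_left (y : Matrix (Fin m) (Fin ν) ℝ × (Fin K → ℝ))
    (z z' : Matrix (Fin n) (Fin n) ℝ × (Fin K → ℝ)) {a b : ℝ} (hab : a + b = 1) :
    lagrangian A B σ S (a • z + b • z') y =
      a * lagrangian A B σ S z y + b * lagrangian A B σ S z' y := by
  have h3 : ∑ k, y.2 k * ((a • z + b • z').2 k - (S k * (a • z + b • z').1).trace) =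
      a * ∑ k, y.2 k * (z.2 k - (S k * z.1).trace) +
        b * ∑ k, y.2 k * (z'.2 k - (S k * z'.1).trace) := by
    rw [Finset.mul_sum, Finset.mul_sum, ← Finset.sum_add_distrib]
    refine Finset.sum_congr rfl fun k _ => ?_
    simp only [Prod.snd_add, Prod.smul_snd, Prod.fst_add, Prod.smul_fst, Pi.add_apply,
      Pi.smul_apply, smul_eq_mul, Matrix.mul_add, Matrix.mul_smul, Matrix.trace_add,
      Matrix.trace_smul]
    ring
  obtain rfl : b = 1 - a := by linarith
  simp only [lagrangian, h3]
  simp only [Prod.fst_add, Prod.smul_fst, Matrix.mul_add, Matrix.mul_smul, Matrix.add_mul,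
    Matrix.smul_mul, Matrix.trace_add, Matrix.trace_smul, smul_eq_mul]
  ring

/-- Positive semidefinite matrices with entries bounded by `R`. -/
def psdBox (n : ℕ) (R : ℝ) : Set (Matrix (Fin n) (Fin n) ℝ) :=
  {Q | Q.PosSemidef ∧ ∀ i j, Q i j ∈ Set.Icc (-R) R}

lemma isCompact_psdBox (n : ℕ) (R : ℝ) : IsCompact (psdBox n R) := by
  have h1 : IsCompact (Set.pi Set.univ fun _ => Set.pi Set.univ fun _ => Set.Icc (-R) R :
      Set (Matrix (Fin n) (Fin n) ℝ)) :=
    isCompact_univ_pi fun _ => isCompact_univ_pi fun _ => isCompact_Icc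
  refine h1.of_isClosed_subset ?_ fun Q hQ i _ j _ => hQ.2 i j
  simp only [psdBox, Matrix.posSemidef_iff_dotProduct_mulVec, Set.ofPred_and, Set.ofPred_forall]
  refine (IsClosed.inter ?_ (isClosed_iInter fun x => ?_)).inter
    (isClosed_iInter fun i => isClosed_iInter fun j => ?_)
  · exact isClosed_eq continuous_id.matrix_conjTranspose continuous_id
  · exact isClosed_le continuous_const
      (continuous_const.dotProduct (continuous_id.matrix_mulVec continuous_const))
  · exact isClosed_Icc.preimage (continuous_id.matrix_elem i j)

lemma convex_psdBox (n : ℕ) (R : ℝ) : Convex ℝ (psdBox n R) := by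
  intro Q hQ Q' hQ' a b ha hb hab
  exact ⟨(hQ.1.smul ha).add (hQ'.1.smul hb), fun i j =>
    (convex_Icc (-R) R) (hQ.2 i j) (hQ'.2 i j) ha hb hab⟩

lemma zero_mem_psdBox (n : ℕ) {R : ℝ} (hR : 0 ≤ R) : (0 : Matrix (Fin n) (Fin n) ℝ) ∈ psdBox n R :=
  ⟨Matrix.PosSemidef.zero, fun i j => by simp [hR]⟩

/-- Rank-one test matrices, by which the Lagrange function sees the semidefinite constraint at x. -/
lemma smul_vecMulVec_mem_psdBox {n : ℕ} {R : ℝ} (hR : 0 ≤ R) {x : EuclideanSpace ℝ (Fin n)}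
    (hx : x ≠ 0) : (R / ‖x‖ ^ 2) • Matrix.vecMulVec x.ofLp x.ofLp ∈ psdBox n R := by
  have hx2 : 0 < ‖x‖ ^ 2 := by positivity
  refine ⟨Matrix.PosSemidef.smul (by simpa using Matrix.posSemidef_vecMulVec_self_star x.ofLp)
    (by positivity), fun i j => ?_⟩
  rw [Set.mem_Icc, ← abs_le, Matrix.smul_apply, Matrix.vecMulVec_apply, smul_eq_mul, abs_mul,
    abs_mul, abs_of_nonneg (by positivity : 0 ≤ R / ‖x‖ ^ 2)]
  have hi : |x i| ≤ ‖x‖ := by simpa using PiLp.norm_apply_le x i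
  have hj : |x j| ≤ ‖x‖ := by simpa using PiLp.norm_apply_le x j
  calc R / ‖x‖ ^ 2 * (|x i| * |x j|) ≤ R / ‖x‖ ^ 2 * (‖x‖ * ‖x‖) := by gcongr
    _ = R := by field_simp

lemma trace_mul_vecMulVec_mul_transpose {p q : ℕ} (M : Matrix (Fin p) (Fin q) ℝ)
    (x : Fin q → ℝ) : (M * Matrix.vecMulVec x x * Mᵀ).trace = (M *ᵥ x) ⬝ᵥ (M *ᵥ x) := by
  rw [Matrix.mul_vecMulVec, Matrix.vecMulVec_mul, Matrix.trace_vecMulVec, Matrix.vecMul_transpose]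

lemma trace_mul_vecMulVec {q : ℕ} (M : Matrix (Fin q) (Fin q) ℝ) (x : Fin q → ℝ) :
    (M * Matrix.vecMulVec x x).trace = x ⬝ᵥ (M *ᵥ x) := by
  rw [Matrix.mul_vecMulVec, Matrix.trace_vecMulVec, dotProduct_comm]

/-- If the Lagrange function at `(H, λ)` is bounded by `c` on a large enough bounded set, then
increasing `λ` turns `(H, λ)` into a feasible solution with objective at most `c`. -/
lemma exists_isFeasible_of_lagrangian_le (hd : IsEllitopeData S T) (hn : 0 < n)
    {H : Matrix (Fin m) (Fin ν) ℝ} {lam : Fin K → ℝ} (hlam : 0 ≤ lam) {c : ℝ}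
    (h : ∀ z ∈ psdBox n (sizeT T / minEigenvalue (∑ k, S k)) ×ˢ T,
      lagrangian A B σ S z (H, lam) ≤ c) :
    ∃ lam' : Fin K → ℝ, IsFeasible A B S H lam' ∧ objective σ T H lam' ≤ c := by
  have hκ := minEigenvalue_pos hn hd.sum_posDef
  have hT := hd.sizeT_pos hn
  set κ := minEigenvalue (∑ k, S k)
  set R := sizeT T / κ with hR
  have hRpos : 0 < R := by positivity
  -- `d` is the slack found at Q = 0. Adding δ = d/T to every λ_k raises φ by at most δT = d.
  -- Testing Q = (R/‖x‖²) xxᵀ bounds the violation of the constraint at x by d‖x‖²/R = δκ‖x‖² ≤ δ ∑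
  -- xᵀS_k x, so the same increase repairs it; this is why R = T/κ.
  set d := c - σ ^ 2 * (Hᵀ * H).trace - supportFn T lam with hddef
  have hd0 : 0 ≤ d := by
    have : supportFn T lam ≤ c - σ ^ 2 * (Hᵀ * H).trace := hd.supportFn_le fun t ht => by
      have := h (0, t) ⟨zero_mem_psdBox n hRpos.le, ht⟩
      simp only [lagrangian, Matrix.mul_zero, Matrix.zero_mul, Matrix.trace_zero, sub_zero,
        add_zero] at this
      simp only [dotProduct]
      linarith
    linarith
  have hδ : 0 ≤ d / sizeT T := by positivity
  refine ⟨fun k => lam k + d / sizeT T, (isFeasible_iff hd).2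
    ⟨fun k => add_nonneg (hlam k) hδ, fun x => ?_⟩, ?_⟩
  · rcases eq_or_ne x 0 with rfl | hx
    · simp
    set u : EuclideanSpace ℝ (Fin n) := WithLp.toLp 2 x with hu
    have hu0 : u ≠ 0 := fun h0 => hx (by ext j; simpa [hu] using congrArg (fun z => z.ofLp j) h0)
    have hun : 0 < ‖u‖ ^ 2 := by positivity
    have h1 : supportFn T lam ≤ c - σ ^ 2 * (Hᵀ * H).trace - R / ‖u‖ ^ 2 *
        (((B - Hᵀ * A) *ᵥ x) ⬝ᵥ ((B - Hᵀ * A) *ᵥ x) - ∑ k, lam k * (x ⬝ᵥ (S k *ᵥ x))) := by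
      refine hd.supportFn_le fun t ht => ?_
      have h2 := h (_, t) ⟨smul_vecMulVec_mem_psdBox hRpos.le hu0, ht⟩
      simp only [lagrangian, Matrix.mul_smul, Matrix.smul_mul, Matrix.trace_smul, smul_eq_mul,
        trace_mul_vecMulVec_mul_transpose, trace_mul_vecMulVec, mul_sub, Finset.sum_sub_distrib]
        at h2
      have h3 : ∑ k, lam k * (R / ‖u‖ ^ 2 * (u.ofLp ⬝ᵥ (S k *ᵥ u.ofLp))) =
          R / ‖u‖ ^ 2 * ∑ k, lam k * (x ⬝ᵥ (S k *ᵥ x)) := by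
        rw [Finset.mul_sum]
        exact Finset.sum_congr rfl fun k _ => by simp only [hu]; ring
      rw [h3] at h2
      simp only [hu] at h2 ⊢
      simp only [dotProduct] at h2 ⊢
      linarith
    have h4 : R * (((B - Hᵀ * A) *ᵥ x) ⬝ᵥ ((B - Hᵀ * A) *ᵥ x) -
        ∑ k, lam k * (x ⬝ᵥ (S k *ᵥ x))) ≤ d * ‖u‖ ^ 2 := by
      have : R / ‖u‖ ^ 2 * (((B - Hᵀ * A) *ᵥ x) ⬝ᵥ ((B - Hᵀ * A) *ᵥ x) -
        ∑ k, lam k * (x ⬝ᵥ (S k *ᵥ x))) ≤ d := by linarith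
      rwa [div_mul_eq_mul_div, div_le_iff₀ hun] at this
    have h5 := minEigenvalue_mul_norm_sq_le hd.sum_posDef.isHermitian u
    rw [dotProduct_sum_mulVec] at h5
    have h6 : ((B - Hᵀ * A) *ᵥ x) ⬝ᵥ ((B - Hᵀ * A) *ᵥ x) -
        ∑ k, lam k * (x ⬝ᵥ (S k *ᵥ x)) ≤ d / sizeT T * (κ * ‖u‖ ^ 2) := by
      have : d / sizeT T * (κ * ‖u‖ ^ 2) = d * ‖u‖ ^ 2 / R := by
        rw [hR]; field_simp
      rw [this, le_div_iff₀ hRpos]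
      linarith
    have h7 := mul_le_mul_of_nonneg_left h5 hδ
    simp only [add_mul, Finset.sum_add_distrib, ← Finset.mul_sum]
    simp only [hu] at h7 h6
    linarith
  · have h1 : supportFn T (fun k => lam k + d / sizeT T) ≤ supportFn T lam + d := by
      refine hd.supportFn_le fun t ht => ?_
      have h2 := hd.le_supportFn lam ht
      have h3 : (fun k => lam k + d / sizeT T) ⬝ᵥ t = lam ⬝ᵥ t + d / sizeT T * ∑ k, t k := by
        simp only [dotProduct, add_mul, Finset.sum_add_distrib, Finset.mul_sum]
      have h4 := mul_le_mul_of_nonneg_left (hd.sum_le_sizeT ht) hδ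
      rw [div_mul_cancel₀ _ hT.ne'] at h4
      linarith
    rw [objective]
    linarith

/-- A least favourable covariance: strong duality, up to an arbitrarily small loss. -/
lemma IsOptimalSolution.exists_covariance (hd : IsEllitopeData S T) (hn : 0 < n)
    {H₀ : Matrix (Fin m) (Fin ν) ℝ} {lam₀ : Fin K → ℝ}
    (hopt : IsOptimalSolution A B σ S T H₀ lam₀) {c : ℝ} (hc : c < objective σ T H₀ lam₀) :
    ∃ Q : Matrix (Fin n) (Fin n) ℝ, Q.PosSemidef ∧ ∃ t ∈ T, (∀ k, (S k * Q).trace ≤ t k) ∧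
      ∀ H : Matrix (Fin m) (Fin ν) ℝ, c ≤ σ ^ 2 * (Hᵀ * H).trace +
        ((B - Hᵀ * A) * Q * (B - Hᵀ * A)ᵀ).trace := by
  have hκ := minEigenvalue_pos hn hd.sum_posDef
  have hT := hd.sizeT_pos hn
  set X := psdBox n (sizeT T / minEigenvalue (∑ k, S k)) ×ˢ T with hX
  set Y : Set (Matrix (Fin m) (Fin ν) ℝ × (Fin K → ℝ)) := {y | 0 ≤ y.2} with hY
  have hYc : Convex ℝ Y := fun y hy y' hy' a b ha hb _ => by
    simp only [hY, Set.mem_ofPred_eq, Prod.snd_add, Prod.smul_snd] at hy hy' ⊢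
    exact add_nonneg (smul_nonneg ha hy) (smul_nonneg hb hy')
  have hXc : Convex ℝ X := (convex_psdBox n _).prod hd.convex
  obtain ⟨t₀, ht₀, -⟩ := hd.exists_pos
  have hXne : X.Nonempty := ⟨(0, t₀), zero_mem_psdBox n (by positivity), ht₀⟩
  -- If every (Q, t) had a response with Lagrange function below `c`, one (H, λ) would serve for all
  -- of them and produce a feasible point better than the optimum. The signs are reversed because
  -- the compact variable is the minimizing one in the minimax theorem.
  by_cases hex : ∀ z ∈ X, ∃ y ∈ Y, -c < -lagrangian A B σ S z y
  · exfalso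
    obtain ⟨⟨H, lam⟩, hlam, hlt⟩ := exists_forall_lt_of_convexOn_of_concaveOn
      (f := fun z y => -lagrangian A B σ S z y) hXne
      ((isCompact_psdBox n _).prod hd.isCompact)
      (fun y => (continuous_lagrangian_left (A := A) (B := B) (σ := σ) (S := S) y).neg)
      (fun z => (continuous_lagrangian_right z).neg)
      (fun y _ => ⟨hXc, fun z _ z' _ a b _ _ hab => by
        simp only [lagrangian_affine_left y z z' hab, smul_eq_mul]; linarith⟩)
      (fun z hz => (convexOn_lagrangian hz.1.1 hYc).neg) hex
    obtain ⟨lam', hf, hle⟩ := exists_isFeasible_of_lagrangian_le hd hn (A := A) (B := B) (σ := σ)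
      (H := H) (lam := lam) hlam (fun z hz => (neg_lt_neg_iff.1 (hlt z hz)).le)
    exact absurd (hopt.2 H lam' hf) (by linarith)
  · push Not at hex
    obtain ⟨⟨Q, t⟩, ⟨hQ, ht⟩, hge⟩ := hex
    have hge' : ∀ y ∈ Y, c ≤ lagrangian A B σ S (Q, t) y := fun y hy => by
      linarith [hge y hy]
    refine ⟨Q, hQ.1, t, ht, fun k => ?_, fun H => ?_⟩
    -- If Tr(S_k Q) > t_k, a large λ_k drives the Lagrange function below `c`; `s` is chosen to
    -- lower it by |v - c| + 1.
    · by_contra! hlt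
      set v := lagrangian A B σ S (Q, t) ((0 : Matrix (Fin m) (Fin ν) ℝ), 0)
      set s := (|v - c| + 1) / ((S k * Q).trace - t k) with hs
      have hpos : 0 < (S k * Q).trace - t k := by linarith
      have hs0 : 0 ≤ s := by positivity
      have h1 := hge' (0, Pi.single k s) (by
        simp only [hY, Set.mem_ofPred_eq]; exact Pi.single_nonneg.2 hs0)
      have h2 : lagrangian A B σ S (Q, t) ((0 : Matrix (Fin m) (Fin ν) ℝ), Pi.single k s) =
          v + s * (t k - (S k * Q).trace) := by
        simp only [v, lagrangian]
        congr 1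
        · simp
        · rw [Finset.sum_eq_single k]
          · simp
          · intro j _ hj; simp [hj]
          · simp
      have h3 : s * ((S k * Q).trace - t k) = |v - c| + 1 := by
        rw [hs]; field_simp
      have h4 := le_abs_self (v - c)
      nlinarith
    · have := hge' (H, 0) (by simp [hY])
      simpa [lagrangian] using this

end Duality

/-! ### From the Gaussian prior to a lower bound on the risk over the ellitope -/

section LowerBound

variable {m n ν K : ℕ} {A : Matrix (Fin m) (Fin n) ℝ} {B : Matrix (Fin ν) (Fin n) ℝ} {σ : ℝ}
  {S : Fin K → Matrix (Fin n) (Fin n) ℝ} {T : Set (Fin K → ℝ)}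

/-- With S = DDᵀ the quadratic form at Lη is ‖DᵀLη‖², whose mean is Tr(SLLᵀ). -/
lemma lintegral_exp_quadratic_le {S : Matrix (Fin n) (Fin n) ℝ} (hS : S.PosSemidef)
    (L : Matrix (Fin n) (Fin n) ℝ) {t : ℝ} (ht : 0 < t) (h : (S * (L * Lᵀ)).trace ≤ t) :
    ∫⁻ η, ENNReal.ofReal (Real.exp (((Matrix.toEuclideanLin L η).ofLp ⬝ᵥ
      (S *ᵥ (Matrix.toEuclideanLin L η).ofLp)) / t / 4))
      ∂(stdGaussian (EuclideanSpace ℝ (Fin n))) ≤ 2 := by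
  obtain ⟨D, rfl⟩ := exists_eq_mul_transpose hS
  have h1 : (Dᵀ * L * (Dᵀ * L)ᵀ).trace ≤ t := by
    refine le_trans (le_of_eq ?_) h
    rw [Matrix.transpose_mul, Matrix.transpose_transpose, ← Matrix.mul_assoc, Matrix.trace_mul_comm]
    simp only [Matrix.mul_assoc]
  refine le_trans (le_of_eq ?_) (lintegral_exp_norm_toEuclideanLin_sq (Dᵀ * L) ht h1)
  refine lintegral_congr fun η => ?_
  rw [toEuclideanLin_mul, norm_toEuclideanLin_sq_eq_dotProduct, ← Matrix.mulVec_mulVec,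
    Matrix.dotProduct_mulVec, ← Matrix.mulVec_transpose]

lemma smul_mem_ellitope {t : Fin K → ℝ} (ht : t ∈ T) {x : EuclideanSpace ℝ (Fin n)} {s : ℝ}
    (h : ∀ k, s ^ 2 * (x.ofLp ⬝ᵥ (S k *ᵥ x.ofLp)) ≤ t k) : s • x ∈ ellitope S T := by
  refine ⟨t, ht, fun k => le_trans (le_of_eq ?_) (h k)⟩
  simp only [WithLp.ofLp_smul, Matrix.mulVec_smul, smul_dotProduct, dotProduct_smul, smul_eq_mul]
  ring

/-- Away from the ellitope the squared loss is dominated by the exponential moments. -/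
lemma loss_bound_of_large {t : Fin K → ℝ} (ht : t ∈ T)
    (hpos : ∀ k, 0 < t k) {N : ℝ}
    (hN : ∀ x ∈ ellitope S T, ‖Matrix.toEuclideanLin B x‖ ^ 2 ≤ N) {ρ : ℝ} (hρ : 0 < ρ)
    (hρ1 : ρ ≤ 1) {x : EuclideanSpace ℝ (Fin n)} {k₀ : Fin K}
    (hk₀ : t k₀ < ρ * (x.ofLp ⬝ᵥ (S k₀ *ᵥ x.ofLp))) :
    8 * N + 2 * ‖Matrix.toEuclideanLin B (√ρ • x)‖ ^ 2 ≤ 80 * N * Real.exp (-(1 / (8 * ρ))) *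
      ∑ k, Real.exp ((x.ofLp ⬝ᵥ (S k *ᵥ x.ofLp)) / t k / 4) := by
  set y : Fin K → ℝ := fun k => (x.ofLp ⬝ᵥ (S k *ᵥ x.ofLp)) / t k with hy
  have : Nonempty (Fin K) := ⟨k₀⟩
  obtain ⟨k, hk⟩ := Finite.exists_max y
  have hyk : 1 < ρ * y k := by
    have h1 : 1 < ρ * y k₀ := by
      rw [hy, ← mul_div_assoc, one_lt_div (hpos k₀)]; exact hk₀
    exact h1.trans_le (mul_le_mul_of_nonneg_left (hk k₀) hρ.le)
  have hy0 : 0 < y k := pos_of_mul_pos_right (one_pos.trans hyk) hρ.le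
  -- The largest ratio y_k tells how far x must be scaled back to enter the ellitope, so ‖Bx‖² ≤ y_k
  -- N.
  have hmem : (√(y k))⁻¹ • x ∈ ellitope S T := by
    refine smul_mem_ellitope ht fun j => ?_
    rw [inv_pow, Real.sq_sqrt hy0.le, inv_mul_le_iff₀ hy0, ← div_le_iff₀ (hpos j)]
    exact hk j
  have hB : ‖Matrix.toEuclideanLin B x‖ ^ 2 ≤ y k * N := by
    have h1 := hN _ hmem
    rw [map_smul, norm_smul, mul_pow, Real.norm_eq_abs, sq_abs, inv_pow, Real.sq_sqrt hy0.le,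
      inv_mul_le_iff₀ hy0] at h1
    exact h1
  have hN0 : 0 ≤ N := by
    by_contra! h
    nlinarith [sq_nonneg ‖Matrix.toEuclideanLin B x‖]
  rw [map_smul, norm_smul, mul_pow, Real.norm_eq_abs, sq_abs, Real.sq_sqrt hρ.le]
  have h1 : y k ≤ 8 * Real.exp (y k / 8) := by
    linarith [Real.add_one_le_exp (y k / 8)]
  -- Half of the exponent y/4 is traded for the small factor, using y > 1/ρ; the other half absorbs
  -- the linear growth of the loss.
  have h2 : Real.exp (y k / 8) ≤ Real.exp (-(1 / (8 * ρ))) * Real.exp (y k / 4) := by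
    rw [← Real.exp_add, Real.exp_le_exp]
    have : 1 / (8 * ρ) ≤ y k / 8 := by
      rw [div_le_div_iff₀ (by positivity) (by norm_num)]; nlinarith
    linarith
  have h3 : Real.exp (y k / 4) ≤ ∑ k, Real.exp (y k / 4) :=
    Finset.single_le_sum (f := fun k => Real.exp (y k / 4)) (fun _ _ => Real.exp_nonneg _)
      (Finset.mem_univ k)
  calc 8 * N + 2 * (ρ * ‖Matrix.toEuclideanLin B x‖ ^ 2)
      ≤ 8 * N * (ρ * y k) + 2 * (ρ * (y k * N)) := by
        refine add_le_add (le_mul_of_one_le_right (by positivity) hyk.le) ?_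
        gcongr
    _ = 10 * N * (ρ * y k) := by ring
    _ ≤ 10 * N * (8 * Real.exp (y k / 8)) := by
        exact mul_le_mul_of_nonneg_left ((mul_le_of_le_one_left hy0.le hρ1).trans h1)
          (by positivity)
    _ ≤ 10 * N * (8 * (Real.exp (-(1 / (8 * ρ))) * ∑ k, Real.exp (y k / 4))) := by
        gcongr
        exact h2.trans (by gcongr)
    _ = _ := by ring

/-- Truncation of an estimate does not increase its loss on signals with a bounded image. -/
lemma enorm_truncation_sub_le {E : Type*} [NormedAddCommGroup E] {v b : E} {D : ℝ}
    (hb : ‖b‖ ≤ D) : ‖(if ‖v‖ ≤ 2 * D then v else 0) - b‖ₑ ≤ ‖v - b‖ₑ := by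
  split_ifs with h
  · exact le_rfl
  · rw [enorm_le_iff_norm_le, zero_sub, norm_neg]
    have := norm_sub_norm_le v b
    push Not at h
    linarith

lemma lintegral_loss_le_risk_sq {X : Set (EuclideanSpace ℝ (Fin n))}
    (w : EuclideanSpace ℝ (Fin m) → EuclideanSpace ℝ (Fin ν)) {x : EuclideanSpace ℝ (Fin n)}
    (hx : x ∈ X) :
    ∫⁻ ξ, ‖w (Matrix.toEuclideanLin A x + σ • ξ) - Matrix.toEuclideanLin B x‖ₑ ^ 2
      ∂(stdGaussian (EuclideanSpace ℝ (Fin m))) ≤ risk A B σ X w ^ 2 := by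
  have h : (∫⁻ ξ, ‖w (Matrix.toEuclideanLin A x + σ • ξ) - Matrix.toEuclideanLin B x‖ₑ ^ 2
      ∂(stdGaussian (EuclideanSpace ℝ (Fin m)))) ^ (1 / 2 : ℝ) ≤ risk A B σ X w :=
    le_iSup₂ (f := fun x (_ : x ∈ X) =>
      (∫⁻ ξ, ‖w (Matrix.toEuclideanLin A x + σ • ξ) - Matrix.toEuclideanLin B x‖ₑ ^ 2
        ∂(stdGaussian (EuclideanSpace ℝ (Fin m)))) ^ (1 / 2 : ℝ)) x hx
  have h2 := pow_le_pow_left' h 2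
  rwa [← ENNReal.rpow_natCast, ← ENNReal.rpow_mul, show (1 / 2 : ℝ) * ((2 : ℕ) : ℝ) = 1 by norm_num,
    ENNReal.rpow_one] at h2

/-- The risk of an arbitrary estimate is bounded below by the Bayes risk for a shrunken Gaussian
prior, up to a correction for the prior mass outside the ellitope. -/
lemma ofReal_le_risk_sq_add (hd : IsEllitopeData S T) (hσ : 0 < σ)
    {w : EuclideanSpace ℝ (Fin m) → EuclideanSpace ℝ (Fin ν)} (hw : Measurable w)
    {N : ℝ} (hN0 : 0 ≤ N) (hN : ∀ x ∈ ellitope S T, ‖Matrix.toEuclideanLin B x‖ ^ 2 ≤ N)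
    {Q : Matrix (Fin n) (Fin n) ℝ} (hQ : Q.PosSemidef) {t : Fin K → ℝ} (ht : t ∈ T)
    (hpos : ∀ k, 0 < t k) (htr : ∀ k, (S k * Q).trace ≤ t k) {c : ℝ}
    (hc : ∀ H : Matrix (Fin m) (Fin ν) ℝ, c ≤ σ ^ 2 * (Hᵀ * H).trace +
        ((B - Hᵀ * A) * Q * (B - Hᵀ * A)ᵀ).trace) {ρ : ℝ} (hρ : 0 < ρ) (hρ1 : ρ ≤ 1) :
    ENNReal.ofReal (ρ * c) ≤ risk A B σ (ellitope S T) w ^ 2 +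
      ENNReal.ofReal (160 * (K * N) * Real.exp (-(1 / (8 * ρ)))) := by
  obtain ⟨L, rfl⟩ := exists_eq_mul_transpose hQ
  -- A value beyond 2√N is farther than 0 from every point of the ball of radius √N, so truncation
  -- is harmless on the ellitope. Elsewhere it bounds the loss by 8N + 2‖Bx‖².
  set w' : EuclideanSpace ℝ (Fin m) → EuclideanSpace ℝ (Fin ν) :=
    fun y => if ‖w y‖ ≤ 2 * √N then w y else 0 with hw'
  have hw'm : Measurable w' :=
    Measurable.ite (measurableSet_le hw.norm measurable_const) hw measurable_const
  have hw'b : ∀ y, ‖w' y‖ ≤ 2 * √N := by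
    intro y
    simp only [hw']
    split_ifs with h
    · exact h
    · simp
  obtain ⟨H, hH⟩ := bayes_risk_lower_bound A B hσ (√ρ • L) hw'm hw'b
  set e := Real.exp (-(1 / (8 * ρ)))
  have hLη : ∀ η : EuclideanSpace ℝ (Fin n), Matrix.toEuclideanLin (√ρ • L) η =
      √ρ • Matrix.toEuclideanLin L η := fun η => by simp
  simp_rw [hLη] at hH
  -- Only the bias term scales with ρ; the noise term dominates ρ times itself because ρ ≤ 1.
  have hval : ρ * c ≤ σ ^ 2 * (Hᵀ * H).trace +
      ((B - Hᵀ * A) * ((√ρ • L) * (√ρ • L)ᵀ) * (B - Hᵀ * A)ᵀ).trace := by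
    have h1 : (√ρ • L) * (√ρ • L)ᵀ = ρ • (L * Lᵀ) := by
      rw [Matrix.transpose_smul, Matrix.smul_mul, Matrix.mul_smul, smul_smul,
        Real.mul_self_sqrt hρ.le]
    rw [h1, Matrix.mul_smul, Matrix.smul_mul, Matrix.trace_smul, smul_eq_mul]
    have h2 := mul_le_mul_of_nonneg_left (hc H) hρ.le
    have h3 : 0 ≤ σ ^ 2 * (Hᵀ * H).trace :=
      mul_nonneg (sq_nonneg _) (trace_transpose_mul_self_nonneg H)
    nlinarith
  have hpt : ∀ η : EuclideanSpace ℝ (Fin n),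
      ∫⁻ ξ, ‖w' (Matrix.toEuclideanLin A (√ρ • Matrix.toEuclideanLin L η) + σ • ξ) -
        Matrix.toEuclideanLin B (√ρ • Matrix.toEuclideanLin L η)‖ₑ ^ 2
        ∂(stdGaussian (EuclideanSpace ℝ (Fin m))) ≤
      risk A B σ (ellitope S T) w ^ 2 + ENNReal.ofReal (80 * N * e) *
        ∑ k, ENNReal.ofReal (Real.exp (((Matrix.toEuclideanLin L η).ofLp ⬝ᵥ
          (S k *ᵥ (Matrix.toEuclideanLin L η).ofLp)) / t k / 4)) := by
    intro η
    set x := Matrix.toEuclideanLin L η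
    by_cases hgood : ∀ k, ρ * (x.ofLp ⬝ᵥ (S k *ᵥ x.ofLp)) ≤ t k
    · have hx : √ρ • x ∈ ellitope S T :=
        smul_mem_ellitope ht fun k => by rw [Real.sq_sqrt hρ.le]; exact hgood k
      refine le_trans ?_ (le_self_add (a := risk A B σ (ellitope S T) w ^ 2))
      refine le_trans (lintegral_mono fun ξ => ?_) (lintegral_loss_le_risk_sq w hx)
      exact pow_le_pow_left' (enorm_truncation_sub_le (Real.le_sqrt_of_sq_le (hN _ hx))) 2
    · push Not at hgood
      obtain ⟨k₀, hk₀⟩ := hgood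
      refine le_trans ?_ (le_add_self (a := ENNReal.ofReal (80 * N * e) * _))
      rw [← ENNReal.ofReal_sum_of_nonneg fun k _ => Real.exp_nonneg _,
        ← ENNReal.ofReal_mul (by positivity)]
      refine le_trans (lintegral_mono (g := fun _ => ENNReal.ofReal (80 * N * e * ∑ k,
        Real.exp ((x.ofLp ⬝ᵥ (S k *ᵥ x.ofLp)) / t k / 4))) fun ξ => ?_) (by simp)
      refine le_trans ?_ (ENNReal.ofReal_le_ofReal
        (loss_bound_of_large ht hpos hN hρ hρ1 hk₀))
      rw [← ofReal_norm, ← ENNReal.ofReal_pow (norm_nonneg _)]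
      refine ENNReal.ofReal_le_ofReal ?_
      set v := w' (Matrix.toEuclideanLin A (√ρ • x) + σ • ξ)
      set b := Matrix.toEuclideanLin B (√ρ • x)
      have h1 : ‖v‖ ^ 2 ≤ 4 * N := by
        have := pow_le_pow_left₀ (norm_nonneg _) (hw'b (Matrix.toEuclideanLin A (√ρ • x) + σ • ξ)) 2
        rw [mul_pow, Real.sq_sqrt hN0] at this
        linarith
      have h2 : ‖v - b‖ ^ 2 ≤ (‖v‖ + ‖b‖) ^ 2 :=
        pow_le_pow_left₀ (norm_nonneg _) (norm_sub_le _ _) 2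
      nlinarith [sq_nonneg (‖v‖ - ‖b‖)]
  have hmeas : ∀ k, Measurable fun η : EuclideanSpace ℝ (Fin n) =>
      ENNReal.ofReal (Real.exp (((Matrix.toEuclideanLin L η).ofLp ⬝ᵥ
          (S k *ᵥ (Matrix.toEuclideanLin L η).ofLp)) / t k / 4)) := by
    intro k
    have h1 : Continuous fun η : EuclideanSpace ℝ (Fin n) => (Matrix.toEuclideanLin L η).ofLp :=
      (PiLp.continuous_ofLp 2 _).comp (continuous_toEuclideanLin L)
    have h2 := h1.dotProduct (continuous_const.matrix_mulVec h1 (A := fun _ => S k))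
    exact ENNReal.measurable_ofReal.comp
      (Real.continuous_exp.comp ((h2.div_const _).div_const _)).measurable
  calc ENNReal.ofReal (ρ * c) ≤ _ := (ENNReal.ofReal_le_ofReal hval).trans hH
    _ ≤ _ := lintegral_mono hpt
    _ = risk A B σ (ellitope S T) w ^ 2 + ENNReal.ofReal (80 * N * e) *
        ∑ k, ∫⁻ η, ENNReal.ofReal (Real.exp (((Matrix.toEuclideanLin L η).ofLp ⬝ᵥ
          (S k *ᵥ (Matrix.toEuclideanLin L η).ofLp)) / t k / 4))
          ∂(stdGaussian (EuclideanSpace ℝ (Fin n))) := by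
        rw [lintegral_add_left measurable_const, lintegral_const_mul _
          (Finset.measurable_sum _ fun k _ => hmeas k), lintegral_finsetSum _ fun k _ => hmeas k]
        simp
    _ ≤ risk A B σ (ellitope S T) w ^ 2 + ENNReal.ofReal (80 * N * e) * ∑ _k : Fin K, 2 := by
        gcongr with k
        exact lintegral_exp_quadratic_le (hd.posSemidef k) L (hpos k) (htr k)
    _ = _ := by
        congr 1
        rw [Finset.sum_const, Finset.card_univ, Fintype.card_fin, nsmul_eq_mul,
          show ((K : ℝ≥0∞) * 2) = ENNReal.ofReal (K * 2) by
            rw [ENNReal.ofReal_mul (by positivity)]; simp,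
          ← ENNReal.ofReal_mul (by positivity)]
        congr 1
        ring

end LowerBound

/-! ### Condition numbers and the origin of Θ -/

section Conditioning

variable {m n ν K : ℕ} {A : Matrix (Fin m) (Fin n) ℝ} {B : Matrix (Fin ν) (Fin n) ℝ} {σ : ℝ}
  {S : Fin K → Matrix (Fin n) (Fin n) ℝ} {T : Set (Fin K → ℝ)}

/-- The largest possible smallest entry of an element of `T`. -/
def maxMin (T : Set (Fin K → ℝ)) : ℝ := sSup ((fun t => ⨅ k, t k) '' T)

lemma card_mul_iInf_le (t : Fin K → ℝ) : K * ⨅ k, t k ≤ ∑ k, t k := by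
  have h : ∑ _k : Fin K, (⨅ k, t k) ≤ ∑ k, t k :=
    Finset.sum_le_sum fun k _ => ciInf_le (Set.finite_range t).bddBelow k
  simpa using h

lemma IsEllitopeData.bddAbove_iInf (hd : IsEllitopeData S T) (hK : 0 < K) :
    BddAbove ((fun t => ⨅ k, t k) '' T) := by
  refine ⟨sizeT T / K, ?_⟩
  rintro _ ⟨t, ht, rfl⟩
  rw [le_div_iff₀ (by positivity), mul_comm]
  exact (card_mul_iInf_le t).trans (hd.sum_le_sizeT ht)

lemma IsEllitopeData.maxMin_pos (hd : IsEllitopeData S T) (hK : 0 < K) : 0 < maxMin T := by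
  obtain ⟨t, ht, hpos⟩ := hd.exists_pos
  have : Nonempty (Fin K) := ⟨⟨0, hK⟩⟩
  obtain ⟨k, hk⟩ := exists_eq_ciInf_of_finite (f := t)
  exact (hk ▸ hpos k).trans_le (le_csSup (hd.bddAbove_iInf hK) ⟨t, ht, rfl⟩)

lemma IsEllitopeData.card_mul_maxMin_le (hd : IsEllitopeData S T) (hK : 0 < K) :
    K * maxMin T ≤ sizeT T := by
  obtain ⟨t, ht, -⟩ := hd.exists_pos
  have hK' : (0 : ℝ) < K := by positivity
  rw [mul_comm, ← le_div_iff₀ hK']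
  refine csSup_le ⟨_, t, ht, rfl⟩ ?_
  rintro _ ⟨t, ht, rfl⟩
  rw [le_div_iff₀ hK', mul_comm]
  exact (card_mul_iInf_le t).trans (hd.sum_le_sizeT ht)

/-- The factor 1/2 makes attainment of the supremum unnecessary and costs only a constant. -/
lemma IsEllitopeData.exists_half_maxMin_le (hd : IsEllitopeData S T) (hK : 0 < K) :
    ∃ t ∈ T, ∀ k, maxMin T / 2 ≤ t k := by
  obtain ⟨t₀, ht₀, -⟩ := hd.exists_pos
  obtain ⟨_, ⟨t, ht, rfl⟩, hlt⟩ := exists_lt_of_lt_csSup (s := (fun t => ⨅ k, t k) '' T)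
    ⟨_, t₀, ht₀, rfl⟩ (half_lt_self (hd.maxMin_pos hK))
  exact ⟨t, ht, fun k => hlt.le.trans (ciInf_le (Set.finite_range t).bddBelow k)⟩

lemma singularValues_last_pos (hn : 0 < n) (hB : LinearMap.ker (Matrix.toEuclideanLin B) = ⊥) :
    0 < (Matrix.toEuclideanLin B).singularValues (n - 1) := by
  refine (Matrix.toEuclideanLin B).injective_iff_forall_lt_finrank_singularValues_pos.1
    (LinearMap.ker_eq_bot.1 hB) _ ?_
  simp only [finrank_euclideanSpace, Fintype.card_fin]
  omega

lemma one_le_condB (hn : 0 < n) (hB : LinearMap.ker (Matrix.toEuclideanLin B) = ⊥) :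
    1 ≤ condB B :=
  (one_le_div (singularValues_last_pos hn hB)).2
    ((Matrix.toEuclideanLin B).singularValues_antitone (Nat.zero_le _))

lemma condT_sq (hd : IsEllitopeData S T) (hn : 0 < n) :
    condT T ^ 2 = sizeT T / maxMin T :=
  Real.sq_sqrt (div_nonneg (hd.sizeT_pos hn).le (hd.maxMin_pos (hd.card_pos hn)).le)

/-- A minimum is at most an average, so Cond²(𝒯) ≥ K, and Cond(B) ≥ 1. Hence Θ ≥ 1, and Θ stays away
from 1 when K ≥ 2. -/
lemma card_sq_le_logArg (hd : IsEllitopeData S T) (hn : 0 < n)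
    (hB : LinearMap.ker (Matrix.toEuclideanLin B) = ⊥) :
    (K : ℝ) ^ 2 ≤ logArg A B σ S T := by
  have hK := hd.card_pos hn
  have hκ := minEigenvalue_pos hn hd.sum_posDef
  have hT := hd.sizeT_pos hn
  have h1 : (K : ℝ) ≤ condT T ^ 2 := by
    rw [condT_sq hd hn, le_div_iff₀ (hd.maxMin_pos hK)]
    exact hd.card_mul_maxMin_le hK
  have h2 : 0 ≤ specNorm A ^ 2 * sizeT T / (σ ^ 2 * minEigenvalue (∑ k, S k)) := by positivity
  have h3 : 1 ≤ condB B ^ 2 := one_le_pow₀ (one_le_condB hn hB)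
  calc (K : ℝ) ^ 2 = K * 1 * K := by ring
    _ ≤ K * condB B ^ 2 * (condT T ^ 2 +
        specNorm A ^ 2 * sizeT T / (σ ^ 2 * minEigenvalue (∑ k, S k))) := by
        gcongr
        linarith

lemma IsFeasible.objective_pos (hd : IsEllitopeData S T) (hn : 0 < n) (hσ : 0 < σ)
    (hB : LinearMap.ker (Matrix.toEuclideanLin B) = ⊥)
    {H : Matrix (Fin m) (Fin ν) ℝ} {lam : Fin K → ℝ} (hf : IsFeasible A B S H lam) :
    0 < objective σ T H lam := by
  have hK := hd.card_pos hn
  have hκ := minEigenvalue_pos hn hd.sum_posDef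
  have hτ := hd.maxMin_pos hK
  obtain ⟨t, ht, hle⟩ := hd.exists_half_maxMin_le hK
  have hβ := singularValues_last_pos hn hB
  have h := hf.sq_le_objective hd hn hσ hβ
    (fun x => by simpa using singularValues_last_mul_norm_le (Matrix.toEuclideanLin B) x)
    ht (half_pos hτ) hle
  by_contra! h0
  have : (minEigenvalue (∑ k, S k) / (maxMin T / 2) + specNorm A ^ 2 / σ ^ 2) *
      objective σ T H lam ≤ 0 := mul_nonpos_of_nonneg_of_nonpos (by positivity) h0
  have : 0 < (Matrix.toEuclideanLin B).singularValues (n - 1) ^ 2 / 4 := by positivity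
  linarith

/-- The squared radius of a ball that contains the image of the ellitope under `B`. -/
def imageRadiusSq (B : Matrix (Fin ν) (Fin n) ℝ) (S : Fin K → Matrix (Fin n) (Fin n) ℝ)
    (T : Set (Fin K → ℝ)) : ℝ :=
  (Matrix.toEuclideanLin B).singularValues 0 ^ 2 * (sizeT T / minEigenvalue (∑ k, S k))

lemma norm_sq_le_imageRadiusSq (hd : IsEllitopeData S T) (hn : 0 < n)
    {x : EuclideanSpace ℝ (Fin n)} (hx : x ∈ ellitope S T) :
    ‖Matrix.toEuclideanLin B x‖ ^ 2 ≤ imageRadiusSq B S T := by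
  have h1 := pow_le_pow_left₀ (norm_nonneg _)
    (norm_apply_le_singularValues_zero (Matrix.toEuclideanLin B) x) 2
  rw [mul_pow] at h1
  exact h1.trans (mul_le_mul_of_nonneg_left (hd.norm_sq_le hn hx) (sq_nonneg _))

/-- The eigenvector test gives σ_min(B)² ≤ 8(ϰ/τ + ‖A‖²/σ²) times the objective, with τ = `maxMin
T`. Multiplying by K Cond²(B) T/ϰ turns the bracket into Θ. -/
lemma IsFeasible.card_mul_imageRadiusSq_le (hd : IsEllitopeData S T) (hn : 0 < n) (hσ : 0 < σ)
    (hB : LinearMap.ker (Matrix.toEuclideanLin B) = ⊥)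
    {H : Matrix (Fin m) (Fin ν) ℝ} {lam : Fin K → ℝ} (hf : IsFeasible A B S H lam) :
    K * imageRadiusSq B S T ≤ 8 * logArg A B σ S T * objective σ T H lam := by
  have hK := hd.card_pos hn
  have hκ := minEigenvalue_pos hn hd.sum_posDef
  have hT := hd.sizeT_pos hn
  have hτ := hd.maxMin_pos hK
  have hobj := hf.objective_pos hd hn hσ hB
  obtain ⟨t, ht, hle⟩ := hd.exists_half_maxMin_le hK
  have hβ := singularValues_last_pos hn hB
  have h := hf.sq_le_objective hd hn hσ hβ
    (fun x => by simpa using singularValues_last_mul_norm_le (Matrix.toEuclideanLin B) x)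
    ht (half_pos hτ) hle
  rw [logArg, condT_sq hd hn, condB, imageRadiusSq]
  set β := (Matrix.toEuclideanLin B).singularValues (n - 1)
  set b := (Matrix.toEuclideanLin B).singularValues 0
  set κ := minEigenvalue (∑ k, S k)
  set τ := maxMin T
  set V := objective σ T H lam
  set a := specNorm A
  have h2 : β ^ 2 ≤ 8 * (κ / τ + a ^ 2 / σ ^ 2) * V := by
    have : κ / (τ / 2) = 2 * (κ / τ) := by field_simp
    rw [this] at h
    have h3 : 0 ≤ a ^ 2 / σ ^ 2 * V := by positivity
    nlinarith
  have hF : 0 ≤ K * (b ^ 2 * (sizeT T / κ)) / β ^ 2 := by positivity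
  calc K * (b ^ 2 * (sizeT T / κ)) = K * (b ^ 2 * (sizeT T / κ)) / β ^ 2 * β ^ 2 := by
        field_simp
    _ ≤ K * (b ^ 2 * (sizeT T / κ)) / β ^ 2 * (8 * (κ / τ + a ^ 2 / σ ^ 2) * V) := by
        gcongr
    _ = _ := by field_simp

end Conditioning

/-! ### Choice of the shrinkage and the final constants -/

section Main

variable {m n ν K : ℕ} {A : Matrix (Fin m) (Fin n) ℝ} {B : Matrix (Fin ν) (Fin n) ℝ} {σ : ℝ}
  {S : Fin K → Matrix (Fin n) (Fin n) ℝ} {T : Set (Fin K → ℝ)}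

lemma exp_correction_le {Θ V P : ℝ} (hΘ : 1 ≤ Θ) (hV : 0 < V) (hP : P ≤ 8 * Θ * V) :
    160 * P * Real.exp (-(22 * Real.log (2 * Θ))) ≤ V / (1408 * Real.log (2 * Θ)) := by
  set u := 2 * Θ with hu
  have hu2 : 2 ≤ u := by linarith
  have hu0 : 0 < u := by linarith
  have hL : 0 < Real.log u := Real.log_pos (by linarith)
  have hLu : Real.log u ≤ u := (Real.log_le_sub_one_of_pos hu0).trans (by linarith)
  have hexp : Real.exp (-(22 * Real.log u)) = (u ^ 22)⁻¹ := by
    rw [Real.exp_neg, show (22 : ℝ) * Real.log u = ((22 : ℕ) : ℝ) * Real.log u by norm_num,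
      Real.exp_nat_mul, Real.exp_log hu0]
  rw [hexp, le_div_iff₀ (by positivity), ← div_eq_mul_inv, div_mul_eq_mul_div,
    div_le_iff₀ (by positivity)]
  -- With ln u ≤ u it remains to beat 640 · 1408 u² = 901120 u² by u²², and 901120 < 2²⁰.
  have h20 : (2 : ℝ) ^ 20 ≤ u ^ 20 := by gcongr
  have hP' : 160 * P ≤ 640 * u * V := by rw [hu]; linarith
  calc 160 * P * (1408 * Real.log u) ≤ 640 * u * V * (1408 * u) := by gcongr
    _ = V * (901120 * u ^ 2) := by ring
    _ ≤ V * (u ^ 20 * u ^ 2) := by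
        gcongr
        refine le_trans (by norm_num) h20
    _ = V * u ^ 22 := by ring

lemma IsOptimalSolution.objective_le_risk_sq (hd : IsEllitopeData S T) (hn : 0 < n) (hσ : 0 < σ)
    (hB : LinearMap.ker (Matrix.toEuclideanLin B) = ⊥)
    {H : Matrix (Fin m) (Fin ν) ℝ} {lam : Fin K → ℝ} (hopt : IsOptimalSolution A B σ S T H lam)
    {w : EuclideanSpace ℝ (Fin m) → EuclideanSpace ℝ (Fin ν)} (hw : Measurable w) :
    ENNReal.ofReal (objective σ T H lam / (1408 * Real.log (2 * logArg A B σ S T))) ≤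
      risk A B σ (ellitope S T) w ^ 2 := by
  have hK := hd.card_pos hn
  have hV := hopt.1.objective_pos hd hn hσ hB
  set V := objective σ T H lam
  have hΘ : 1 ≤ logArg A B σ S T :=
    le_trans (one_le_pow₀ (by exact_mod_cast hK)) (card_sq_le_logArg hd hn hB)
  obtain ⟨Q, hQ, t, ht, htr, hc⟩ := hopt.exists_covariance hd hn (half_lt_self hV)
  obtain ⟨t', ht', hpos'⟩ := hd.exists_pos
  -- Some t_k may vanish, so (Q, t) is averaged with (0, t'), t' > 0. This halves the bound V/2 from
  -- duality, whence c = V/4 below.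
  have hmem := hd.convex ht ht' (a := 1 / 2) (b := 1 / 2) (by norm_num) (by norm_num)
    (by norm_num)
  set L := Real.log (2 * logArg A B σ S T) with hL
  have hL2 : 1 / 2 < L := by
    have h1 : Real.log 2 ≤ L := Real.log_le_log (by norm_num) (by linarith)
    linarith [Real.log_two_gt_d9]
  have hLpos : 0 < L := by linarith
  have hN0 : 0 ≤ imageRadiusSq B S T :=
    mul_nonneg (sq_nonneg _) (div_nonneg (hd.sizeT_pos hn).le
      (minEigenvalue_pos hn hd.sum_posDef).le)
  have key := ofReal_le_risk_sq_add (A := A) (B := B) hd hσ hw hN0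
    (fun x hx => norm_sq_le_imageRadiusSq hd hn hx)
    (hQ.smul (show (0 : ℝ) ≤ 1 / 2 by norm_num)) hmem
    (fun k => by
      have h1 := hd.nonneg t ht k
      have h2 := hpos' k
      simp only [Pi.zero_apply, Pi.add_apply, Pi.smul_apply, smul_eq_mul] at h1 ⊢
      linarith)
    (fun k => by
      have h1 := htr k
      have h2 := hpos' k
      simp only [Matrix.mul_smul, Matrix.trace_smul, Pi.add_apply, Pi.smul_apply, smul_eq_mul]
      linarith)
    (c := V / 4)
    (fun H' => by
      have h1 := hc H'
      have h2 : 0 ≤ σ ^ 2 * (H'ᵀ * H').trace :=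
        mul_nonneg (sq_nonneg _) (trace_transpose_mul_self_nonneg H')
      simp only [Matrix.mul_smul, Matrix.smul_mul, Matrix.trace_smul, smul_eq_mul]
      linarith)
    -- Then exp(-1/(8ρ)) = (2Θ)⁻²², and ρV/4 is twice V/(1408L), one half of which pays for the
    -- correction.
    (ρ := 1 / (176 * L)) (by positivity) (by rw [div_le_one (by positivity)]; linarith)
  have hρ : 1 / (8 * (1 / (176 * L))) = 22 * L := by field_simp; norm_num
  have hcorr := exp_correction_le hΘ hV (hopt.1.card_mul_imageRadiusSq_le hd hn hσ hB)
  rw [hρ] at key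
  have hsplit : 1 / (176 * L) * (V / 4) = V / (1408 * L) + V / (1408 * L) := by
    field_simp; norm_num
  rw [hsplit, ENNReal.ofReal_add (by positivity) (by positivity)] at key
  have key2 := key.trans (add_le_add_right (ENNReal.ofReal_le_ofReal hcorr)
    (risk A B σ (ellitope S T) w ^ 2))
  exact (ENNReal.add_le_add_iff_right ENNReal.ofReal_ne_top).1 key2

lemma IsOptimalSolution.risk_le_riskOpt (hd : IsEllitopeData S T) (hn : 0 < n) (hσ : 0 < σ)
    (hB : LinearMap.ker (Matrix.toEuclideanLin B) = ⊥)
    {H : Matrix (Fin m) (Fin ν) ℝ} {lam : Fin K → ℝ}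
    (hopt : IsOptimalSolution A B σ S T H lam) :
    risk A B σ (ellitope S T) (linearEstimate H) ≤
      ENNReal.ofReal (38 * √(Real.log (2 * logArg A B σ S T))) *
        riskOpt A B σ (ellitope S T) := by
  have hV := hopt.1.objective_pos hd hn hσ hB
  have hΘ : 1 ≤ logArg A B σ S T :=
    le_trans (one_le_pow₀ (by exact_mod_cast hd.card_pos hn)) (card_sq_le_logArg hd hn hB)
  have hLpos : 0 < Real.log (2 * logArg A B σ S T) := Real.log_pos (by linarith)
  refine (hopt.1.risk_le hd).trans ?_
  set L := Real.log (2 * logArg A B σ S T)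
  set V := objective σ T H lam
  have hlow : ENNReal.ofReal √(V / (1408 * L)) ≤ riskOpt A B σ (ellitope S T) := by
    refine le_iInf₂ fun w hw => ?_
    have h := hopt.objective_le_risk_sq hd hn hσ hB hw
    rw [← Real.sq_sqrt (by positivity : 0 ≤ V / (1408 * L)),
      ENNReal.ofReal_pow (Real.sqrt_nonneg _)] at h
    exact (ENNReal.pow_le_pow_left_iff two_ne_zero).1 h
  -- 38² = 1444 exceeds 1408.
  calc ENNReal.ofReal √V ≤ ENNReal.ofReal (38 * √L * √(V / (1408 * L))) := by
        refine ENNReal.ofReal_le_ofReal (Real.sqrt_le_iff.2 ⟨by positivity, ?_⟩)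
        rw [mul_pow, mul_pow, Real.sq_sqrt hLpos.le, Real.sq_sqrt (by positivity)]
        have : (38 : ℝ) ^ 2 * L * (V / (1408 * L)) = 38 ^ 2 / 1408 * V := by field_simp
        rw [this]
        nlinarith
    _ = ENNReal.ofReal (38 * √L) * ENNReal.ofReal √(V / (1408 * L)) :=
        ENNReal.ofReal_mul (by positivity)
    _ ≤ _ := by gcongr

end Main

end Ellitope

end

theorem corollary1 :
    ∃ C : ℝ, 0 < C ∧
      ∀ (m n ν K : ℕ) (A : Matrix (Fin m) (Fin n) ℝ) (B : Matrix (Fin ν) (Fin n) ℝ) (σ : ℝ)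
        (S : Fin K → Matrix (Fin n) (Fin n) ℝ) (T : Set (Fin K → ℝ)),
        0 < σ → Ellitope.IsEllitopeData S T → B ≠ 0 →
        LinearMap.ker (Matrix.toEuclideanLin B) = ⊥ →
        (∃ (H : Matrix (Fin m) (Fin ν) ℝ) (lam : Fin K → ℝ),
          Ellitope.IsOptimalSolution A B σ S T H lam) ∧
        ∀ (H : Matrix (Fin m) (Fin ν) ℝ) (lam : Fin K → ℝ),
          Ellitope.IsOptimalSolution A B σ S T H lam →
          (2 ≤ K →
            Ellitope.risk A B σ (Ellitope.ellitope S T) (Ellitope.linearEstimate H) ≤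
              ENNReal.ofReal (C * √(Real.log (Ellitope.logArg A B σ S T))) *
                Ellitope.riskOpt A B σ (Ellitope.ellitope S T)) ∧
          Ellitope.risk A B σ (Ellitope.ellitope S T) (Ellitope.linearEstimate H) ≤
            ENNReal.ofReal (C * √(Real.log (2 * Ellitope.logArg A B σ S T))) *
              Ellitope.riskOpt A B σ (Ellitope.ellitope S T) := by
  -- The factor √2 is for K ≥ 2, where Θ ≥ 2 gives ln(2Θ) ≤ 2 ln Θ.
  refine ⟨38 * √2, by positivity, ?_⟩
  intro m n ν K A B σ S T hσ hd hB0 hB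
  have hn : 0 < n := by
    rcases Nat.eq_zero_or_pos n with rfl | h
    · exact absurd (by ext i j; exact j.elim0) hB0
    · exact h
  refine ⟨Ellitope.exists_isOptimalSolution hd hn hσ A B, fun H lam hopt => ?_⟩
  have main := hopt.risk_le_riskOpt hd hn hσ hB
  refine ⟨fun hK => main.trans ?_, main.trans ?_⟩
  · have hΘ : 2 ≤ Ellitope.logArg A B σ S T := by
      have h1 := Ellitope.card_sq_le_logArg (A := A) (σ := σ) hd hn hB
      have h2 : (2 : ℝ) ≤ K := by exact_mod_cast hK
      nlinarith
    have hlog : Real.log (2 * Ellitope.logArg A B σ S T) ≤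
        2 * Real.log (Ellitope.logArg A B σ S T) := by
      rw [Real.log_mul (by norm_num) (by positivity)]
      have := Real.log_le_log (by norm_num) hΘ
      linarith
    rw [mul_assoc 38, ← Real.sqrt_mul (by norm_num)]
    gcongr
  · gcongr
    exact le_mul_of_one_le_right (by norm_num) (Real.one_le_sqrt.2 (by norm_num))
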